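/- **Setting.** Let $\Lambda, n$ be non-negative integers, let $e_1,\dots,e_n\in\{+1,-1\}$ be arbitrary signs, let $T\subseteq\{1,\dots,n\}$, and let $\mathcal M$ be the real vector space of $n$-tuples $X=(X_1,\dots,X_n)$ of complex $\Lambda\times\Lambda$ matrices with $X_i^*=e_iX_i$ for all $i$ and $\operatorname{Tr}X_i=0$ for $i\in T$. (For $T=\emptyset$ there is no trace condition. For the matrix models of fuzzy geometries of signature $(p,q)$ the $e_i$ are the signs determined by $(p,q)$, and $T=\{i: e_i=-1\}$.) Let $d\mu$ be Lebesgue measure on $\mathcal M$, $\operatorname{Tr}(J\cdot\Phi)=\sum_i\operatorname{Tr}(J_i\Phi_i)$, and let $$S[\Phi]=\Lambda\operatorname{Tr}P(\Phi)+\sum_\alpha \operatorname{Tr}\Psi_\alpha(\Phi)\,\operatorname{Tr}\Upsilon_\alpha(\Phi)$$ (a finite sum) with real noncommutative polynomials $P,\Psi_\alpha,\Upsilon_\alpha$ in $n$ variables. Assume that $S$ is real valued on $\mathcal M$ and that $\int_{\mathcal M}e^{-S[\Phi]+\operatorname{Tr}(J\cdot\Phi)}\,d\mu(\Phi)<\infty$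 for every $J\in\mathcal M$. For real $0<N\le\Lambda$ let $r_N(a,c)=r_N(c,a)\ge 0$ $(1\le a,c\le\Lambda)$, and put $$(R_N^\tau)_{ab;cd}=r_N(a,c)\,\delta_{bc}\delta_{ad},\qquad \Delta S_N[\Phi]=\tfrac12\sum_{i=1}^n\sum_{a,b,c,d}e_i(\varphi_i)_{ba}(R_N^\tau)_{ab;cd}(\varphi_i)_{dc},$$ $$\mathcal W_N[J]=\log\int_{\mathcal M} e^{-S[\Phi]-\Delta S_N[\Phi]+\operatorname{Tr}(J\cdot\Phi)}\,d\mu(\Phi),\qquad \Gamma_N[X]=\sup_{J\in\mathcal M}\bigl(\operatorname{Tr}(J\cdot X)-\mathcal W_N[J]\bigr)-\Delta S_N[X].$$ **Tensor operations.** For arrays $A=(A_{ab;cd})$ with indices in $\{1,\dots,\Lambda\}$ let $(A\times B)_{ab;cd}=\sum_{x,y}A_{ax;cy}B_{xb;yd}$ and $(A\star B)_{ab;cd}=\sum_{x,y}A_{ab;xy}B_{yx;cd}$. Let $(1\otimes 1)_{ab;cd}=\delta_{ab}\delta_{cd}$ and $(1\otimes_\tau1)_{ab;cd}=\delta_{cb}\delta_{ad}$.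 Both products extend to $n\times n$ matrices of such arrays (the superspace $M_n(\mathcal A_n)$), and $\mathrm{STr}(Q)=\sum_i\sum_{a,b}Q_{ii|aa;bb}$. A single array $R$ is also written for $1_n\otimes R$. **Derivatives.** $\partial^{X_i}_{ab}=\partial/\partial (X_i)_{ba}$ is the derivative on $\mathcal M$, extended complex-linearly to complex directions, in the direction of the elementary matrix $E_{ba}$ in the $i$-th slot (of its traceless part if $i\in T$). Put $(\mathrm{Hess}\,f)_{ij|ab;cd}=\partial^{X_i}_{cb}\partial^{X_j}_{ad}f$. With $\sigma=\operatorname{diag}(e_1,\dots,e_n)$ let $\mathrm{Hess}_\sigma=\sigma\cdot\mathrm{Hess}$, i.e. $(\mathrm{Hess}_\sigma f)_{ij}=e_i\,\partial^{X_i}\partial^{X_j}f$, and let $\mathrm{Hess}_\sigma^\tau=(1\otimes_\tau 1)\times\mathrm{Hess}_\sigma$ (entrywise), so $(\mathrm{Hess}^\tau_\sigma f)_{ij|ab;cd}=e_i\,\partial^{X_i}_{ab}\partial^{X_j}_{cd}f$. **Inverse.** $D^{-1}$ denotes the inverse in $M_n(\mathcal A_n,\star)$, whose unit is $1_n\otimes(1\otimes_\tau1)$.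 If $T\ne\emptyset$, the inverse is that of the compression $u\star D\star u$ in the corner algebra $u\star M_n(\mathcal A_n)\star u$, where $u$ is diagonal with entry $1\otimes_\tau1-\Lambda^{-1}\,1\otimes1$ for $i\in T$ (the projection onto traceless matrices) and $1\otimes_\tau1$ for $i\notin T$. **Proposition.** Let $0<N\le\Lambda$, and suppose that each $r_N(a,c)$ is differentiable in $t=\log N$ at this $N$ (within $t\le\log\Lambda$). Then the supremum defining $\Gamma_N$ is finite, $\Gamma_N$ is of class $C^2$ on $\mathcal M$, and for every $X\in\mathcal M$ the element $\mathrm{Hess}_\sigma^\tau\Gamma_N[X]+R_N^\tau$ is invertible in the above sense, $t\mapsto\Gamma_N[X]$ is differentiable at this $N$ (within $t\le\log\Lambda$), and $$\partial_t\Gamma_N[X]=\tfrac12\,\mathrm{STr}\Bigl(\partial_tR_N^\tau\times\bigl(\mathrm{Hess}_\sigma^\tau\Gamma_N[X]+R_N^\tau\bigr)^{-1}\Bigr).$$ If moreover all $e_i=+1$, or all $e_i$ are equal and $n\le2$, the same holds with $\mathrm{Hess}_\sigma$ replaced by the Hessian in which only the diagonal entries carry signs, $e_i^{\delta_{ij}}\,\partial^{X_i}\partial^{X_j}$.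 -/

import Mathlib

open MeasureTheory

-- The sup norm of matrix entries; only the topology it induces matters here.
attribute [local instance] Matrix.normedAddCommGroup Matrix.normedSpace

noncomputable section

namespace MatrixFRG

/-! ### Tensors with four matrix indices, and the superspace `M_n(A_{n,Λ})` -/

/-- Elements of `A_{n,Λ}` in coordinates `(a b ; c d)`, each index in `{1, …, Λ}`. -/
abbrev Tensor4 (L : ℕ) : Type := Fin L → Fin L → Fin L → Fin L → ℂ

/-- Elements `(T_{ij | ab;cd})` of the superspace `M_n(A_{n,Λ})`, the matrix indices of `M_n`
running through the finite index set `ι` of the `n` matrices. -/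
abbrev Superspace (ι : Type*) (L : ℕ) : Type _ := ι → ι → Tensor4 L

variable {ι : Type*} [Fintype ι] [DecidableEq ι] {L : ℕ}

/-- `(U ⊗ W)_{ab;cd} = U_{ab} W_{cd}`. -/
def tens (U W : Matrix (Fin L) (Fin L) ℂ) : Tensor4 L := fun a b c d => U a b * W c d

/-- The twisted tensor product `(U ⊗_τ W)_{ab;cd} = (U ⊗ W)_{cb;ad}`, `τ = (13)`. -/
def tensTau (U W : Matrix (Fin L) (Fin L) ℂ) : Tensor4 L := fun a b c d => tens U W c b a d

/-- `(A × B)_{ab;cd} = ∑_{x,y} A_{ax;cy} B_{xb;yd}`. -/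
def times (A B : Tensor4 L) : Tensor4 L :=
  fun a b c d => ∑ x, ∑ y, A a x c y * B x b y d

/-- `(A ⋆ B)_{ab;cd} = ∑_{x,y} A_{ab;xy} B_{yx;cd}`. -/
def star (A B : Tensor4 L) : Tensor4 L :=
  fun a b c d => ∑ x, ∑ y, A a b x y * B y x c d

/-- The product of `M_n(A_n)` built from the product `×` of the entries. -/
def superTimes (P Q : Superspace ι L) : Superspace ι L :=
  fun i j => ∑ k, times (P i k) (Q k j)

/-- The product of `M_n(A_n, ⋆)`: matrix product with the entries multiplied by `⋆`. -/
def superStar (P Q : Superspace ι L) : Superspace ι L :=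
  fun i j => ∑ k, star (P i k) (Q k j)

/-- The supertrace `STr = Tr_n ⊗ Tr_{A_n}`. -/
def superTrace (Q : Superspace ι L) : ℂ := ∑ i, ∑ a, ∑ b, Q i i a a b b

/-- The unit of the superspace algebra of the model under `⋆`. For an index `i` outside `T` the
diagonal entry is `1 ⊗_τ 1`, so that `T = ∅` gives the unit `1_n ⊗ 1 ⊗_τ 1` of `M_n(A_n, ⋆)`.
For `i ∈ T` (a traceless matrix) it is `1 ⊗_τ 1 - Λ⁻¹ 1 ⊗ 1`, which is the idempotent that acts
as the projection onto the traceless matrices. -/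
def superUnit (T : Finset ι) : Superspace ι L := fun i j =>
  if i = j then
    (if i ∈ T then tensTau 1 1 - (L : ℂ)⁻¹ • tens 1 1 else tensTau 1 1)
  else 0

/-- `G` is the inverse of `D` with respect to `⋆`, on the components of the model: with
`u = superUnit T`, `G` lies in the corner algebra `u ⋆ M_n(A_n) ⋆ u` and is there a two-sided
inverse of the compression of `D`. For `T = ∅`, where `u` is the unit `1_n ⊗ 1 ⊗_τ 1` of
`M_n(A_n, ⋆)`, this says that `D ⋆ G = G ⋆ D = 1_n ⊗ 1 ⊗_τ 1`. -/
def IsStarInverse (T : Finset ι) (D G : Superspace ι L) : Prop :=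
  superStar (superStar (superUnit T) G) (superUnit T) = G ∧
    superStar (superStar (superUnit T) D) G = superUnit T ∧
    superStar (superStar G D) (superUnit T) = superUnit T

/-! ### The space of matrices of the model -/

/-- The traceless part of `E` if `i ∈ T`, and `E` itself otherwise. -/
def traceProj (T : Finset ι) (i : ι) (E : Matrix (Fin L) (Fin L) ℂ) :
    Matrix (Fin L) (Fin L) ℂ :=
  if i ∈ T then E - ((L : ℂ)⁻¹ * E.trace) • (1 : Matrix (Fin L) (Fin L) ℂ) else E

/-- The real vector space of tuples of `Λ × Λ` matrices with `X_i^* = e_i X_i` for all `i`, and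
`Tr X_i = 0` for `i ∈ T`. -/
def fields (L : ℕ) (e : ι → ℤˣ) (T : Finset ι) :
    Submodule ℝ (ι → Matrix (Fin L) (Fin L) ℂ) where
  carrier := {X | (∀ i, (X i).conjTranspose = ((e i : ℤ) : ℂ) • X i) ∧
    ∀ i ∈ T, (X i).trace = 0}
  zero_mem' := by simp
  add_mem' := by
    rintro X Y ⟨hX, hX'⟩ ⟨hY, hY'⟩
    refine ⟨fun i => ?_, fun i hi => ?_⟩
    · simp [hX i, hY i]
    · simp [hX' i hi, hY' i hi]
  smul_mem' := by
    rintro c X ⟨hX, hX'⟩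
    refine ⟨fun i => ?_, fun i hi => ?_⟩
    · simp only [Pi.smul_apply, Matrix.conjTranspose_smul, hX i, star_trivial]
      rw [smul_comm]
    · simp [hX' i hi]

theorem trace_traceProj (T : Finset ι) (i : ι) (hi : i ∈ T) (E : Matrix (Fin L) (Fin L) ℂ) :
    (traceProj T i E).trace = 0 := by
  rcases Nat.eq_zero_or_pos L with h | h
  · subst h
    simp [Matrix.trace]
  · have hL : (L : ℂ) ≠ 0 := by exact_mod_cast h.ne'
    simp [traceProj, hi, Matrix.trace_sub, Matrix.trace_smul]
    field_simp
    simp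

/-- The tuple with `i`-th entry `(E' + e_i E'^*) / 2`, where `E'` is `traceProj T i E`, and all the
other entries zero. A tuple with `i`-th entry `E'` and other entries zero is
`fieldPart i E + √-1 • fieldPart i (-√-1 • E)`, with both tuples in the real space `fields`. -/
def fieldPart (e : ι → ℤˣ) (T : Finset ι) (i : ι) (E : Matrix (Fin L) (Fin L) ℂ) :
    fields L e T :=
  ⟨Pi.single i ((1 / 2 : ℂ) • (traceProj T i E +
      ((e i : ℤ) : ℂ) • (traceProj T i E).conjTranspose)), by
    refine ⟨fun j => ?_, fun j hj => ?_⟩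
    · by_cases h : j = i
      · subst h
        rcases Int.units_eq_one_or (e j) with he | he <;>
          simp [he, add_comm, Matrix.conjTranspose_smul]
      · simp [Pi.single_eq_of_ne h]
    · by_cases h : j = i
      · subst h
        simp [Matrix.trace_smul, Matrix.trace_add, Matrix.trace_conjTranspose,
          trace_traceProj T j hj]
      · simp [Pi.single_eq_of_ne h]⟩

/-- The matrix derivative `∂^{X_i}_{ab} = ∂ / ∂(X_i)_{ba}` on the (anti-)Hermitian matrices: the
real-linear derivative of `f` at `X`, extended complex-linearly to all matrix directions, in
the direction of the elementary matrix `E_{ba}` (of its traceless part if `i ∈ T`) in the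
`i`-th matrix. -/
def matDeriv (e : ι → ℤˣ) (T : Finset ι) (i : ι) (a b : Fin L) (f : fields L e T → ℂ) :
    fields L e T → ℂ := fun X =>
  fderiv ℝ f X (fieldPart e T i (Matrix.single b a 1)) +
    Complex.I * fderiv ℝ f X (fieldPart e T i ((-Complex.I) • Matrix.single b a 1))

/-! ### Hessians -/

/-- The noncommutative Hessian, `(Hess f)_{ij | ab;cd} = ∂^{X_i}_{cb} ∂^{X_j}_{ad} f`. -/
def ncHess (e : ι → ℤˣ) (T : Finset ι) (f : fields L e T → ℝ) (X : fields L e T) :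
    Superspace ι L := fun i j a b c d =>
  matDeriv e T i c b (matDeriv e T j a d (fun Y => (f Y : ℂ))) X

/-- `Hess_σ = σ · Hess` with `σ = diag(e_1, …, e_n)`: the entry `ij` is `e_i ∂^{X_i} ∂^{X_j}`. -/
def hessSigma (e : ι → ℤˣ) (T : Finset ι) (f : fields L e T → ℝ) (X : fields L e T) :
    Superspace ι L := fun i j => ((e i : ℤ) : ℂ) • ncHess e T f X i j

/-- The Hessian with only its diagonal entries scaled by the signs: the entry `ij` is
`e_i^{δ_{ij}} ∂^{X_i} ∂^{X_j}`. -/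
def hessSigmaDiag (e : ι → ℤˣ) (T : Finset ι) (f : fields L e T → ℝ) (X : fields L e T) :
    Superspace ι L := fun i j =>
  (if i = j then ((e i : ℤ) : ℂ) else 1) • ncHess e T f X i j

/-- The twisted version `(1 ⊗_τ 1) × H` of `H`, entry by entry. -/
def twisted (H : Superspace ι L) : Superspace ι L := fun i j => times (tensTau 1 1) (H i j)

/-! ### The model -/

/-- The bare action `Λ Tr P(Φ) + ∑_α Tr Ψ_α(Φ) · Tr Υ_α(Φ)` of real noncommutative polynomials. -/
def bareAction {κ : Type*} [Fintype κ] (P : FreeAlgebra ℝ ι) (Ps Up : κ → FreeAlgebra ℝ ι)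
    (Φ : ι → Matrix (Fin L) (Fin L) ℂ) : ℂ :=
  (L : ℂ) * (FreeAlgebra.lift ℝ Φ P).trace +
    ∑ α, (FreeAlgebra.lift ℝ Φ (Ps α)).trace * (FreeAlgebra.lift ℝ Φ (Up α)).trace

/-- `Tr (J · Φ) = ∑_i Tr (J_i Φ_i)`. On tuples with `X_i^* = e_i X_i` it is real. -/
def sourceTerm (J Φ : ι → Matrix (Fin L) (Fin L) ℂ) : ℂ := ∑ i, (J i * Φ i).trace

/-- `(R^τ)_{ab;cd} = r(a,c) (1 ⊗_τ 1)_{ab;cd}`. -/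
def regulator (r : Fin L → Fin L → ℝ) : Tensor4 L := fun a b c d =>
  (r a c : ℂ) * tensTau 1 1 a b c d

/-- `1_n ⊗ R^τ` in the superspace. -/
def superRegulator (r : Fin L → Fin L → ℝ) : Superspace ι L := fun i j =>
  if i = j then regulator r else 0

/-- The regulator term
`ΔS[Φ] = (1/2) ∑_{a,b,c,d} ∑_i e_i (φ_i)_{ba} (R^τ)_{ab;cd} (φ_i)_{dc}`.
On tuples with `X_i^* = e_i X_i` it is real. -/
def regTerm (e : ι → ℤˣ) (r : Fin L → Fin L → ℝ) (Φ : ι → Matrix (Fin L) (Fin L) ℂ) : ℂ :=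
  (1 / 2 : ℂ) * ∑ a, ∑ b, ∑ c, ∑ d, ∑ i,
    ((e i : ℤ) : ℂ) * Φ i b a * regulator r a b c d * Φ i d c

/-- The regulated free energy
`W[J] = log ∫ exp (-S[Φ] - ΔS[Φ] + Tr (J · Φ)) dμ(Φ)`. -/
def freeEnergy (e : ι → ℤˣ) (T : Finset ι) [MeasurableSpace (fields L e T)]
    (μ : Measure (fields L e T)) (S : (ι → Matrix (Fin L) (Fin L) ℂ) → ℂ)
    (r : Fin L → Fin L → ℝ) (J : fields L e T) : ℝ :=
  Real.log (∫ Φ : fields L e T,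
    Real.exp (-(S Φ).re - (regTerm e r Φ).re + (sourceTerm J.1 Φ.1).re) ∂μ)

/-- The interpolating effective action
`Γ[X] = sup_J (Tr (J · X) - W[J]) - ΔS[X]`. -/
def effAction (e : ι → ℤˣ) (T : Finset ι) [MeasurableSpace (fields L e T)]
    (μ : Measure (fields L e T)) (S : (ι → Matrix (Fin L) (Fin L) ℂ) → ℂ)
    (r : Fin L → Fin L → ℝ) (X : fields L e T) : ℝ :=
  (⨆ J : fields L e T, ((sourceTerm J.1 X.1).re - freeEnergy e T μ S r J)) -
    (regTerm e r X).re

end MatrixFRG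

end

open MatrixFRG

/-!
# The flow equation for the effective action of a multi-matrix model

The space of fields is a finite-dimensional real vector space `E`, and the sources, paired with the
fields by `Tr (J · X)`, are all the linear forms on `E`. With the action `s = S + ΔS`, the free
energy is the function `logZ : l ↦ log ∫ exp (-s + l)` on the dual space. Since the regulator term
is nonnegative and all exponential moments of `exp (-S)` are finite, `logZ` may be differentiated
under the integral sign: its gradient at `l` is the mean `⟨x⟩_l`, and its second derivative is the
covariance, which is positive definite because the density is positive everywhere. For the same
reason `logZ l - l x` grows at least linearly in `l` for every `x` (`Confining.logZ_coercive`).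
Hence the gradient is a `C¹` bijection from sources to fields with invertible derivative, the
Legendre transform is finite and of class `C²`, its gradient at `x` is the source `l` with
`⟨x⟩_l = x`, and its second derivative is the inverse of the covariance (`SteepConvex`).

For the scale derivative at fixed `x`, the regulator is differentiable at a single scale only, from
one side only, and possibly on the boundary of the region of nonnegative regulators, so that the
integral need not make sense for nearby coefficients. Jensen's inequality
(`Confining.logZ_sub_avg_le`) bounds the change of `logZ` from both sides by expectations of the
change of the action, and coercivity, uniform in the scale, localizes the supremum near its
maximizer. This gives the envelope theorem `Confining.hasDerivWithinAt_legendre`: the derivative of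
the Legendre transform is the expectation of the derivative of `ΔS`. Subtracting the derivative of
`ΔS[X]` leaves half the trace of the derivative of the regulator against the covariance.

It remains to recognize the covariance as the inverse in the superspace. Reading a tensor
`P_{ij | ab;cd}` as the matrix with row `(i, a, b)` and column `(j, d, c)` turns `⋆` into the matrix
product and the unit `u` into the projection onto the traceless matrices in the slots of `T`
(`toMatrix_superStar`, `superUnit_mulVec`). Matrix derivatives are values of a complex-linear
extension at elementary matrices, and these values are the coefficients of a form with respect to
the matrix entries (`sum_complexExt_mul`); hence the product of the Hessian of the Legendre
transform with the tensor of the covariances `e_k ⟨(φ_i)_{ab}; (φ_k)_{cd}⟩` is `u`, because one is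
the inverse of the other on the real space of fields (`hessTensor_mul_propagator`). The Hessian of
`ΔS` is the compression of the regulator by `u`, which accounts for the term `R`. When the signs
occur on the diagonal only, the Hessian is conjugate to the former one by a diagonal matrix of signs
(`IsStarInverse.conj_sign`).
-/

set_option linter.unusedSectionVars false

namespace ExpFamily

open Filter Topology

variable {E F : Type*} [NormedAddCommGroup E] [NormedSpace ℝ E]
  [NormedAddCommGroup F] [NormedSpace ℝ F]

/-! ### Functions of exponential growth -/

/-- Continuous functions of at most exponential growth. -/
def ExpBounded (g : E → F) : Prop :=
  Continuous g ∧ ∃ a C : ℝ, ∀ x, ‖g x‖ ≤ C * Real.exp (a * ‖x‖)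

theorem ExpBounded.exists_nonneg {g : E → F} (hg : ExpBounded g) :
    ∃ a C : ℝ, 0 ≤ a ∧ 0 ≤ C ∧ ∀ x, ‖g x‖ ≤ C * Real.exp (a * ‖x‖) := by
  obtain ⟨-, a, C, h⟩ := hg
  refine ⟨|a|, |C|, abs_nonneg _, abs_nonneg _, fun x => (h x).trans ?_⟩
  have := norm_nonneg x
  gcongr
  · exact le_abs_self _
  · exact le_abs_self _

theorem expBounded_const (c : F) : ExpBounded (fun _ : E => c) :=
  ⟨continuous_const, 0, ‖c‖, fun x => by simp⟩

theorem expBounded_clm (k : E →L[ℝ] F) : ExpBounded k := by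
  refine ⟨k.continuous, 1, ‖k‖, fun x => (k.le_opNorm x).trans ?_⟩
  have := Real.add_one_le_exp ‖x‖
  rw [one_mul]
  gcongr
  linarith

theorem expBounded_id : ExpBounded (fun x : E => x) := expBounded_clm (ContinuousLinearMap.id ℝ E)

theorem ExpBounded.add {g h : E → F} (hg : ExpBounded g) (hh : ExpBounded h) :
    ExpBounded (fun x => g x + h x) := by
  obtain ⟨a, C, ha, hC, H⟩ := hg.exists_nonneg
  obtain ⟨b, D, hb, hD, K⟩ := hh.exists_nonneg
  refine ⟨hg.1.add hh.1, a + b, C + D, fun x => (norm_add_le _ _).trans ?_⟩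
  have := norm_nonneg x
  rw [add_mul]
  refine add_le_add ((H x).trans ?_) ((K x).trans ?_) <;> gcongr <;> linarith

theorem ExpBounded.bilin {G K : Type*} [NormedAddCommGroup G] [NormedSpace ℝ G]
    [NormedAddCommGroup K] [NormedSpace ℝ K] {g : E → F} {h : E → G}
    (hg : ExpBounded g) (hh : ExpBounded h) (A : F →L[ℝ] G →L[ℝ] K) :
    ExpBounded (fun x => A (g x) (h x)) := by
  obtain ⟨a, C, -, hC, H⟩ := hg.exists_nonneg
  obtain ⟨b, D, -, hD, K⟩ := hh.exists_nonneg
  refine ⟨(A.continuous.comp hg.1).clm_apply hh.1, a + b, ‖A‖ * C * D, fun x => ?_⟩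
  calc ‖A (g x) (h x)‖ ≤ ‖A‖ * ‖g x‖ * ‖h x‖ := A.le_opNorm₂ _ _
    _ ≤ ‖A‖ * (C * Real.exp (a * ‖x‖)) * (D * Real.exp (b * ‖x‖)) := by
      gcongr
      · exact H x
      · exact K x
    _ = _ := by rw [add_mul, Real.exp_add]; ring

theorem ExpBounded.mul {A : Type*} [NormedRing A] [NormedAlgebra ℝ A] {g h : E → A}
    (hg : ExpBounded g) (hh : ExpBounded h) : ExpBounded (fun x => g x * h x) :=
  hg.bilin hh (ContinuousLinearMap.mul ℝ A)

theorem ExpBounded.smul {g : E → ℝ} {h : E → F}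
    (hg : ExpBounded g) (hh : ExpBounded h) : ExpBounded (fun x => g x • h x) :=
  hg.bilin hh (ContinuousLinearMap.lsmul ℝ ℝ)

theorem ExpBounded.finsetSum {K : Type*}
    {f : K → E → F} (hf : ∀ k, ExpBounded (f k)) (u : Finset K) :
    ExpBounded fun x => ∑ k ∈ u, f k x := by
  classical
  induction u using Finset.induction_on with
  | empty => simpa using expBounded_const (0 : F)
  | insert k u hk ih =>
    simp only [Finset.sum_insert hk]
    exact (hf k).add ih

/-- The function `x ↦ (k ↦ k x • g x)`, which is the integrand that a derivative in the
source `k` brings down. -/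
noncomputable def insertion (g : E → F) (x : E) : (E →L[ℝ] ℝ) →L[ℝ] F :=
  (ContinuousLinearMap.apply ℝ ℝ x).smulRight (g x)

@[simp] theorem insertion_apply (g : E → F) (x : E) (k : E →L[ℝ] ℝ) :
    insertion g x k = k x • g x := rfl

theorem ExpBounded.insertion {g : E → F} (hg : ExpBounded g) : ExpBounded (insertion g) := by
  exact ExpBounded.bilin (F := (E →L[ℝ] ℝ) →L[ℝ] ℝ) (G := F) (K := (E →L[ℝ] ℝ) →L[ℝ] F)
    (expBounded_clm (ContinuousLinearMap.id ℝ (E →L[ℝ] ℝ)).flip) hg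
    (ContinuousLinearMap.smulRightL ℝ (E →L[ℝ] ℝ) F)

variable [MeasurableSpace E]

/-! ### Moments of a confining action -/

/-- A continuous action `s` whose weight `exp (-s)` has all exponential moments. -/
structure Confining (μ : Measure E) (s : E → ℝ) : Prop where
  continuous : Continuous s
  integrable : ∀ c : ℝ, Integrable (fun x => Real.exp (c * ‖x‖ - s x)) μ

/-- The unnormalized expectation `∫ exp (-s x + ℓ x) g x dμ(x)` in the presence of the
source `ℓ`. -/
noncomputable def moment (μ : Measure E) (s : E → ℝ) (g : E → F) (l : E →L[ℝ] ℝ) : F :=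
  ∫ x, Real.exp (-s x + l x) • g x ∂μ

/-- The logarithm of the partition function, as a function of the source. -/
noncomputable def logZ (μ : Measure E) (s : E → ℝ) (l : E →L[ℝ] ℝ) : ℝ :=
  Real.log (∫ x, Real.exp (-s x + l x) ∂μ)

/-- The normalized expectation of `g` in the presence of the source `l`. -/
noncomputable def avg (μ : Measure E) (s : E → ℝ) (l : E →L[ℝ] ℝ) (g : E → F) : F :=
  (moment μ s (fun _ => (1 : ℝ)) l)⁻¹ • moment μ s g l

theorem logZ_eq (μ : Measure E) (s : E → ℝ) (l : E →L[ℝ] ℝ) :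
    logZ μ s l = Real.log (moment μ s (fun _ => (1 : ℝ)) l) := by
  simp [logZ, moment]

/-- In finite dimensions, integrability against the exponentials of all linear forms gives
integrability against `exp (c ‖x‖)`: the latter is dominated by a finite sum of the former. -/
theorem confining_of_integrable [FiniteDimensional ℝ E] [BorelSpace E] {μ : Measure E} {s : E → ℝ}
    (hs : Continuous s)
    (h : ∀ l : E →L[ℝ] ℝ, Integrable (fun x => Real.exp (-s x + l x)) μ) :
    Confining μ s := by
  refine ⟨hs, fun c => ?_⟩
  let b := Module.finBasis ℝ E
  let φ : E ≃L[ℝ] (Fin (Module.finrank ℝ E) → ℝ) := b.equivFunL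
  let K : ℝ := |c| * ‖(φ.symm : (Fin (Module.finrank ℝ E) → ℝ) →L[ℝ] E)‖
  have hK : 0 ≤ K := by positivity
  let k : Fin (Module.finrank ℝ E) → E →L[ℝ] ℝ := fun i =>
    K • ((ContinuousLinearMap.proj i).comp (φ : E →L[ℝ] (Fin (Module.finrank ℝ E) → ℝ)))
  have hk : ∀ i x, k i x = K * φ x i := fun i x => rfl
  have hdom : Integrable (fun x => Real.exp (-s x + (0 : E →L[ℝ] ℝ) x) +
      ∑ i, (Real.exp (-s x + k i x) + Real.exp (-s x + (-k i) x))) μ :=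
    (h 0).add (integrable_finsetSum _ fun i _ => (h _).add (h _))
  refine hdom.mono' ?_ (Eventually.of_forall fun x => ?_)
  · have := hs
    exact (by fun_prop : Continuous fun x => Real.exp (c * ‖x‖ - s x)).aestronglyMeasurable
  · rw [Real.norm_eq_abs, Real.abs_exp]
    have hx : c * ‖x‖ ≤ K * ‖φ x‖ := by
      have h1 : ‖x‖ ≤ ‖(φ.symm : (Fin (Module.finrank ℝ E) → ℝ) →L[ℝ] E)‖ * ‖φ x‖ := by
        have := (φ.symm : (Fin (Module.finrank ℝ E) → ℝ) →L[ℝ] E).le_opNorm (φ x)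
        simpa using this
      calc c * ‖x‖ ≤ |c| * ‖x‖ := by gcongr; exact le_abs_self _
        _ ≤ |c| * (‖(φ.symm : (Fin (Module.finrank ℝ E) → ℝ) →L[ℝ] E)‖ * ‖φ x‖) := by gcongr
        _ = _ := by ring
    have hpos : ∀ i, 0 ≤ Real.exp (-s x + k i x) + Real.exp (-s x + (-k i) x) := fun i => by
      positivity
    -- the sup norm of the coordinates is attained at some coordinate, unless there is none
    rcases isEmpty_or_nonempty (Fin (Module.finrank ℝ E)) with he | he
    · have : ‖φ x‖ = 0 := by
        rw [norm_eq_zero]; exact Subsingleton.elim _ _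
      rw [this, mul_zero] at hx
      refine le_trans ?_ (le_add_of_nonneg_right (Finset.sum_nonneg fun i _ => hpos i))
      apply Real.exp_le_exp.2
      simp only [zero_apply]
      linarith
    · obtain ⟨i, hi⟩ : ∃ i, ‖φ x‖ = |φ x i| := by
        obtain ⟨i, hi⟩ := Finite.exists_max (fun i => ‖φ x i‖)
        refine ⟨i, le_antisymm ?_ (norm_le_pi_norm (φ x) i)⟩
        exact (pi_norm_le_iff_of_nonneg (norm_nonneg _)).2 hi
      refine le_trans ?_ (le_add_of_nonneg_left (Real.exp_pos _).le)
      refine le_trans ?_ (Finset.single_le_sum (fun i _ => hpos i) (Finset.mem_univ i))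
      rw [hi] at hx
      rcases abs_choice (φ x i) with h' | h'
      · refine le_trans ?_ (le_add_of_nonneg_right (Real.exp_pos _).le)
        apply Real.exp_le_exp.2
        rw [hk, ← h']; linarith
      · refine le_trans ?_ (le_add_of_nonneg_left (Real.exp_pos _).le)
        apply Real.exp_le_exp.2
        rw [neg_apply, hk]
        rw [h'] at hx; linarith

theorem Confining.integrable_bound [BorelSpace E] {μ : Measure E} {s : E → ℝ}
    (hs : Confining μ s) {g : E → F} [SecondCountableTopologyEither E F]
    (hg : ExpBounded g) (c : ℝ) :
    Integrable (fun x => Real.exp (c * ‖x‖ - s x) • g x) μ := by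
  obtain ⟨a, C, -, -, H⟩ := hg.exists_nonneg
  refine ((hs.integrable (c + a)).const_mul C).mono' ?_ (Eventually.of_forall fun x => ?_)
  · have := hs.continuous
    have := hg.1
    exact (by fun_prop : Continuous fun x =>
      Real.exp (c * ‖x‖ - s x) • g x).aestronglyMeasurable
  · rw [norm_smul, Real.norm_eq_abs, Real.abs_exp]
    calc _ ≤ Real.exp (c * ‖x‖ - s x) * (C * Real.exp (a * ‖x‖)) := by gcongr; exact H x
      _ = C * (Real.exp (c * ‖x‖ - s x) * Real.exp (a * ‖x‖)) := by ring
      _ = _ := by rw [← Real.exp_add]; ring_nf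

theorem norm_exp_smul (t : ℝ) (v : F) : ‖Real.exp t • v‖ = Real.exp t * ‖v‖ := by
  rw [norm_smul, Real.norm_eq_abs, Real.abs_exp]

theorem source_le (l : E →L[ℝ] ℝ) (x : E) : l x ≤ ‖l‖ * ‖x‖ :=
  (le_abs_self _).trans (l.le_opNorm x)

theorem Confining.integrable_smul [BorelSpace E] {μ : Measure E} {s : E → ℝ}
    (hs : Confining μ s) {g : E → F} [SecondCountableTopologyEither E F]
    (hg : ExpBounded g) (l : E →L[ℝ] ℝ) :
    Integrable (fun x => Real.exp (-s x + l x) • g x) μ := by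
  refine (hs.integrable_bound hg ‖l‖).mono ?_ (Eventually.of_forall fun x => ?_)
  · have := hs.continuous
    have := hg.1
    exact (by fun_prop : Continuous fun x =>
      Real.exp (-s x + l x) • g x).aestronglyMeasurable
  · simp only [norm_smul, Real.norm_eq_abs, Real.abs_exp]
    gcongr
    linarith [source_le l x]

section Borel
variable [BorelSpace E] [FiniteDimensional ℝ E] {μ : Measure E} {s : E → ℝ}

/-- Differentiation of a moment in the source, under the integral sign. -/
theorem Confining.hasFDerivAt_moment (hs : Confining μ s) {g : E → F} (hg : ExpBounded g)
    (l : E →L[ℝ] ℝ) : HasFDerivAt (moment μ s g) (moment μ s (insertion g) l) l := by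
  have : ProperSpace E := FiniteDimensional.proper ℝ E
  have hc := hs.continuous
  have hgc := hg.1
  have hic := hg.insertion.1
  refine hasFDerivAt_integral_of_dominated_of_fderiv_le (Metric.ball_mem_nhds l one_pos)
    (bound := fun x => ‖Real.exp ((‖l‖ + 1) * ‖x‖ - s x) • insertion g x‖)
    (F := fun l x => Real.exp (-s x + l x) • g x)
    (F' := fun l x => Real.exp (-s x + l x) • insertion g x)
    (Eventually.of_forall fun k => ?_) (hs.integrable_smul hg l) ?_
    (Eventually.of_forall fun x k hk => ?_) (hs.integrable_bound hg.insertion _).norm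
    (Eventually.of_forall fun x k hk => ?_)
  · exact (hs.integrable_smul hg k).aestronglyMeasurable
  · exact (hs.integrable_smul hg.insertion l).aestronglyMeasurable
  · refine (norm_exp_smul _ (insertion g x)).trans_le
      (le_of_le_of_eq ?_ (norm_exp_smul _ (insertion g x)).symm)
    have h1 := source_le k x
    have h2 : ‖k‖ ≤ ‖l‖ + 1 := by
      have := norm_sub_norm_le k l
      rw [Metric.mem_ball, dist_eq_norm] at hk
      linarith
    have h3 : ‖k‖ * ‖x‖ ≤ (‖l‖ + 1) * ‖x‖ := by gcongr
    refine mul_le_mul_of_nonneg_right (Real.exp_le_exp.2 ?_) (norm_nonneg (insertion g x))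
    linarith
  · have h1 : HasFDerivAt (fun k : E →L[ℝ] ℝ => -s x + k x)
        (ContinuousLinearMap.apply ℝ ℝ x) k :=
      (ContinuousLinearMap.hasFDerivAt (ContinuousLinearMap.apply ℝ ℝ x)).const_add _
    refine (h1.exp.smul_const (g x)).congr_fderiv ?_
    ext v
    simp [mul_smul]

theorem Confining.differentiable_moment (hs : Confining μ s) {g : E → F} (hg : ExpBounded g) :
    Differentiable ℝ (moment μ s g) := fun l => (hs.hasFDerivAt_moment hg l).differentiableAt

theorem Confining.continuous_moment (hs : Confining μ s) {g : E → F} (hg : ExpBounded g) :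
    Continuous (moment μ s g) := (hs.differentiable_moment hg).continuous

theorem Confining.contDiff_moment (hs : Confining μ s) {g : E → F} (hg : ExpBounded g) :
    ContDiff ℝ 1 (moment μ s g) := by
  rw [contDiff_one_iff_fderiv]
  refine ⟨hs.differentiable_moment hg, ?_⟩
  rw [show fderiv ℝ (moment μ s g) = moment μ s (insertion g) from
    funext fun l => (hs.hasFDerivAt_moment hg l).fderiv]
  exact hs.continuous_moment hg.insertion

theorem Confining.clm_moment [CompleteSpace F] {G : Type*} [NormedAddCommGroup G] [NormedSpace ℝ G]
    [CompleteSpace G] (hs : Confining μ s) {g : E → F} (hg : ExpBounded g) (A : F →L[ℝ] G)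
    (l : E →L[ℝ] ℝ) : A (moment μ s g l) = moment μ s (fun x => A (g x)) l := by
  have : ProperSpace E := FiniteDimensional.proper ℝ E
  rw [moment, ← A.integral_comp_comm (hs.integrable_smul hg l)]
  simp [moment]

theorem Confining.moment_add (hs : Confining μ s) {g h : E → F} (hg : ExpBounded g)
    (hh : ExpBounded h) (l : E →L[ℝ] ℝ) :
    moment μ s (fun x => g x + h x) l = moment μ s g l + moment μ s h l := by
  have : ProperSpace E := FiniteDimensional.proper ℝ E
  simp only [moment, smul_add]
  exact integral_add (hs.integrable_smul hg l) (hs.integrable_smul hh l)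

theorem Confining.avg_add (hs : Confining μ s) {g h : E → F} (hg : ExpBounded g)
    (hh : ExpBounded h) (l : E →L[ℝ] ℝ) :
    avg μ s l (fun x => g x + h x) = avg μ s l g + avg μ s l h := by
  simp only [avg, hs.moment_add hg hh, smul_add]

theorem Confining.clm_avg [CompleteSpace F] {G : Type*} [NormedAddCommGroup G] [NormedSpace ℝ G]
    [CompleteSpace G] (hs : Confining μ s) {g : E → F} (hg : ExpBounded g) (A : F →L[ℝ] G)
    (l : E →L[ℝ] ℝ) : A (avg μ s l g) = avg μ s l (fun x => A (g x)) := by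
  simp only [avg, map_smul, hs.clm_moment hg]

/-- The mean of the tilted measure. -/
noncomputable def mean (μ : Measure E) (s : E → ℝ) (l : E →L[ℝ] ℝ) : E := avg μ s l fun x => x

/-- The covariance of the tilted measure, as a map from linear forms to vectors. -/
noncomputable def cov (μ : Measure E) (s : E → ℝ) (l : E →L[ℝ] ℝ) : (E →L[ℝ] ℝ) →L[ℝ] E :=
  avg μ s l (insertion fun x => x) -
    (ContinuousLinearMap.apply ℝ ℝ (mean μ s l)).smulRight (mean μ s l)

theorem Confining.cov_apply (hs : Confining μ s) (l k : E →L[ℝ] ℝ) :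
    cov μ s l k = avg μ s l (fun x => k x • x) - k (mean μ s l) • mean μ s l := by
  have : CompleteSpace E := FiniteDimensional.complete ℝ E
  have h := hs.clm_avg expBounded_id.insertion (ContinuousLinearMap.apply ℝ E k) l
  simp only [ContinuousLinearMap.apply_apply, insertion_apply] at h
  simp [cov, h]

/-- A component of the covariance is the covariance of two linear functions. -/
theorem Confining.clm_cov_apply [CompleteSpace F] (hs : Confining μ s) (l k : E →L[ℝ] ℝ)
    (A : E →L[ℝ] F) :
    A (cov μ s l k) = avg μ s l (fun x => k x • A x) - k (mean μ s l) • A (mean μ s l) := by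
  have : CompleteSpace E := FiniteDimensional.complete ℝ E
  rw [hs.cov_apply, map_sub, map_smul, hs.clm_avg ((expBounded_clm k).smul expBounded_id)]
  simp

variable [μ.IsAddHaarMeasure]

/-- The expectation of a nonnegative continuous function that does not vanish identically is
positive, because the density is positive everywhere. -/
theorem Confining.moment_pos (hs : Confining μ s) {g : E → ℝ} (hg : ExpBounded g)
    (h0 : ∀ x, 0 ≤ g x) {x₀ : E} (hx : g x₀ ≠ 0) (l : E →L[ℝ] ℝ) : 0 < moment μ s g l := by
  have : ProperSpace E := FiniteDimensional.proper ℝ E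
  have hc := hs.continuous
  have hgc := hg.1
  have hcont : Continuous fun x => Real.exp (-s x + l x) • g x := by fun_prop
  have hnn : ∀ x, 0 ≤ Real.exp (-s x + l x) • g x := fun x =>
    mul_nonneg (Real.exp_pos _).le (h0 x)
  rw [moment, integral_pos_iff_support_of_nonneg hnn (hs.integrable_smul hg l)]
  refine hcont.isOpen_support.measure_pos μ ⟨x₀, ?_⟩
  rw [Function.mem_support, smul_eq_mul]
  exact mul_ne_zero (Real.exp_pos _).ne' hx

theorem Confining.Z_pos (hs : Confining μ s) (l : E →L[ℝ] ℝ) :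
    0 < moment μ s (fun _ => (1 : ℝ)) l :=
  hs.moment_pos (expBounded_const 1) (fun _ => zero_le_one) (x₀ := 0) one_ne_zero l

theorem Confining.avg_const [CompleteSpace F] (hs : Confining μ s) (l : E →L[ℝ] ℝ) (c : F) :
    avg μ s l (fun _ => c) = c := by
  have h := hs.clm_moment (expBounded_const (1 : ℝ)) ((1 : ℝ →L[ℝ] ℝ).smulRight c) l
  simp only [ContinuousLinearMap.smulRight_apply, one_apply_eq_self, one_smul] at h
  rw [avg, ← h, smul_smul, inv_mul_cancel₀ (hs.Z_pos l).ne', one_smul]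

theorem Confining.continuous_avg (hs : Confining μ s) {g : E → F} (hg : ExpBounded g) :
    Continuous fun l => avg μ s l g :=
  ((hs.continuous_moment (expBounded_const 1)).inv₀ fun l => (hs.Z_pos l).ne').smul
    (hs.continuous_moment hg)

/-- The mean is the gradient of the logarithm of the partition function. -/
theorem Confining.hasFDerivAt_logZ (hs : Confining μ s) (l : E →L[ℝ] ℝ) :
    HasFDerivAt (logZ μ s) (ContinuousLinearMap.apply ℝ ℝ (mean μ s l)) l := by
  have : CompleteSpace E := FiniteDimensional.complete ℝ E
  rw [show logZ μ s = fun l => Real.log (moment μ s (fun _ => (1 : ℝ)) l) from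
    funext fun l => logZ_eq μ s l]
  have hb := expBounded_const (E := E) (1 : ℝ)
  refine ((hs.hasFDerivAt_moment hb l).log (hs.Z_pos l).ne').congr_fderiv ?_
  ext k
  have h := hs.clm_moment hb.insertion (ContinuousLinearMap.apply ℝ ℝ k) l
  simp only [ContinuousLinearMap.apply_apply, insertion_apply] at h
  rw [smul_apply, h, ContinuousLinearMap.apply_apply, mean,
    hs.clm_avg expBounded_id, avg]
  simp

/-- The covariance is the derivative of the mean. -/
theorem Confining.hasFDerivAt_mean (hs : Confining μ s) (l : E →L[ℝ] ℝ) :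
    HasFDerivAt (mean μ s) (cov μ s l) l := by
  have : CompleteSpace E := FiniteDimensional.complete ℝ E
  have hb := expBounded_const (E := E) (1 : ℝ)
  have h1 : HasFDerivAt (fun l => (moment μ s (fun _ => (1 : ℝ)) l)⁻¹) _ l :=
    (hasDerivAt_inv (hs.Z_pos l).ne').comp_hasFDerivAt l (hs.hasFDerivAt_moment hb l)
  refine (h1.smul (hs.hasFDerivAt_moment expBounded_id l)).congr_fderiv ?_
  ext k
  have h := hs.clm_moment hb.insertion (ContinuousLinearMap.apply ℝ ℝ k) l
  have h' := hs.clm_moment expBounded_id.insertion (ContinuousLinearMap.apply ℝ E k) l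
  simp only [ContinuousLinearMap.apply_apply, insertion_apply] at h h'
  have h2 := hs.clm_moment expBounded_id k l
  have hZ := (hs.Z_pos l).ne'
  rw [hs.cov_apply]
  simp only [mean, avg, add_apply, smul_apply,
    ContinuousLinearMap.smulRight_apply, h, h', map_smul, h2, smul_eq_mul, smul_smul, mul_one,
    sub_eq_add_neg, ← neg_smul]
  congr 2
  field_simp

theorem Confining.contDiff_mean (hs : Confining μ s) : ContDiff ℝ 1 (mean μ s) :=
  ((hs.contDiff_moment (expBounded_const 1)).inv fun l => (hs.Z_pos l).ne').smul
    (hs.contDiff_moment expBounded_id)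

/-- The covariance is positive definite. -/
theorem Confining.cov_pos (hs : Confining μ s) (l k : E →L[ℝ] ℝ) (hk : k ≠ 0) :
    0 < k (cov μ s l k) := by
  have : CompleteSpace E := FiniteDimensional.complete ℝ E
  set m := k (mean μ s l) with hm
  have hkb := expBounded_clm k
  have hdev : ExpBounded fun x => k x + -m := hkb.add (expBounded_const (-m))
  obtain ⟨y, hy⟩ : ∃ y, k y ≠ 0 := by
    by_contra! h
    exact hk (ContinuousLinearMap.ext h)
  have hpos : 0 < avg μ s l (fun x => (k x + -m) * (k x + -m)) := by
    refine mul_pos (inv_pos.2 (hs.Z_pos l)) ?_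
    refine hs.moment_pos (hdev.mul hdev) (fun x => mul_self_nonneg _)
      (x₀ := ((m + 1) / k y) • y) ?_ l
    simp [hy]
  have hmean : avg μ s l (fun x => k x) = m := by
    rw [hm, mean, hs.clm_avg expBounded_id]
  have hlin : avg μ s l (fun x => (-(2 * m)) * k x) = (-(2 * m)) * m := by
    have h := hs.clm_avg hkb ((-(2 * m)) • (1 : ℝ →L[ℝ] ℝ)) l
    simp only [smul_apply, one_apply_eq_self, smul_eq_mul] at h
    rw [← h, hmean]
  -- the quadratic form is the variance of `k`
  have hexp : avg μ s l (fun x => (k x + -m) * (k x + -m)) =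
      avg μ s l (fun x => k x * k x) - m * m := by
    have hl : ExpBounded fun x => (-(2 * m)) * k x := (expBounded_const (-(2 * m))).mul hkb
    rw [show (fun x => (k x + -m) * (k x + -m)) =
      fun x => k x * k x + ((-(2 * m)) * k x + m * m) from funext fun x => by ring,
      hs.avg_add (hkb.mul hkb) (hl.add (expBounded_const _)),
      hs.avg_add hl (expBounded_const _), hlin, hs.avg_const]
    ring
  rw [hs.clm_cov_apply]
  simpa [hexp] using hpos

/-- Since the density is bounded below on balls, the partition function grows exponentially in
every direction, also after recentring at a point `x`. -/
theorem Confining.logZ_coercive (hs : Confining μ s) (x : E) :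
    ∃ c : ℝ, ∀ l : E →L[ℝ] ℝ, l x - logZ μ s l ≤ c - 1 / 4 * ‖l‖ := by
  have : ProperSpace E := FiniteDimensional.proper ℝ E
  obtain ⟨M, hM⟩ := (isCompact_closedBall x 2).bddAbove_image hs.continuous.continuousOn
  have hM' : ∀ z ∈ Metric.closedBall x 2, s z ≤ M := fun z hz => hM ⟨z, hz, rfl⟩
  set V := μ.real (Metric.ball (0 : E) (1 / 4)) with hV
  have hVpos : 0 < V :=
    ENNReal.toReal_pos (Metric.measure_ball_pos μ _ (by norm_num)).ne' measure_ball_lt_top.ne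
  refine ⟨M - Real.log V, fun l => ?_⟩
  -- a direction in which `l` attains half of its norm
  obtain ⟨v, hv1, hv2⟩ : ∃ v : E, ‖v‖ ≤ 1 ∧ 1 / 2 * ‖l‖ ≤ l v := by
    rcases eq_or_ne l 0 with rfl | hl
    · exact ⟨0, by simp, by simp⟩
    · obtain ⟨v, hv, hlv⟩ := l.exists_lt_apply_of_lt_opNorm
        (show 1 / 2 * ‖l‖ < ‖l‖ by linarith [norm_pos_iff.2 hl])
      rw [Real.norm_eq_abs] at hlv
      rcases abs_choice (l v) with h | h
      · exact ⟨v, hv.le, by linarith⟩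
      · exact ⟨-v, by rw [norm_neg]; exact hv.le, by rw [map_neg]; linarith⟩
  have hlow : ∀ z ∈ Metric.ball (x + v) (1 / 4),
      -M + l x + 1 / 4 * ‖l‖ ≤ -s z + l z := by
    intro z hz
    rw [Metric.mem_ball, dist_eq_norm] at hz
    have h1 : s z ≤ M := hM' z (by
      rw [Metric.mem_closedBall, dist_eq_norm]
      have := norm_add_le (z - (x + v)) v
      rw [show z - (x + v) + v = z - x by abel] at this
      linarith)
    have h2 : l (x + v - z) ≤ ‖l‖ * (1 / 4) := by
      refine (source_le l _).trans ?_
      rw [norm_sub_rev]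
      gcongr
    rw [map_sub, map_add] at h2
    linarith
  have hint : Integrable (fun z => Real.exp (-s z + l z)) μ := by
    simpa using hs.integrable_smul (expBounded_const (1 : ℝ)) l
  have hZ : V * Real.exp (-M + l x + 1 / 4 * ‖l‖) ≤ ∫ z, Real.exp (-s z + l z) ∂μ := by
    calc V * Real.exp (-M + l x + 1 / 4 * ‖l‖)
        = ∫ _ in Metric.ball (x + v) (1 / 4), Real.exp (-M + l x + 1 / 4 * ‖l‖) ∂μ := by
          rw [setIntegral_const, smul_eq_mul, hV, measureReal_def, measureReal_def,
            Measure.addHaar_ball_center μ (x + v)]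
      _ ≤ ∫ z in Metric.ball (x + v) (1 / 4), Real.exp (-s z + l z) ∂μ := by
          refine setIntegral_mono_on (integrableOn_const measure_ball_lt_top.ne)
            hint.integrableOn measurableSet_ball fun z hz => Real.exp_le_exp.2 (hlow z hz)
      _ ≤ _ := setIntegral_le_integral hint (Eventually.of_forall fun z => (Real.exp_pos _).le)
  have hlog := Real.log_le_log (by positivity) hZ
  rw [Real.log_mul hVpos.ne' (Real.exp_pos _).ne', Real.log_exp] at hlog
  rw [logZ]
  linarith

end Borel
end ExpFamily

namespace ExpFamily

open Filter Topology

variable {E : Type*} [NormedAddCommGroup E] [NormedSpace ℝ E] [FiniteDimensional ℝ E]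

/-! ### The Legendre transform -/

theorem finrank_strongDual : Module.finrank ℝ (E →L[ℝ] ℝ) = Module.finrank ℝ E := by
  rw [← (LinearMap.toContinuousLinearMap : (E →ₗ[ℝ] ℝ) ≃ₗ[ℝ] (E →L[ℝ] ℝ)).finrank_eq]
  exact Subspace.dual_finrank_eq

theorem surjective_of_injective_strongDual {φ : E →ₗ[ℝ] (E →L[ℝ] ℝ)} (h : Function.Injective φ) :
    Function.Surjective φ :=
  (LinearMap.injective_iff_surjective_of_finrank_eq_finrank finrank_strongDual.symm).1 h

/-- A function `w` on the dual space with gradient `m`, whose Hessian `C` is continuous and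
positive definite, and which grows at least linearly around every point. The Legendre transform
of such a function is finite and of class `C²`. -/
structure SteepConvex (w : (E →L[ℝ] ℝ) → ℝ) (m : (E →L[ℝ] ℝ) → E)
    (C : (E →L[ℝ] ℝ) → (E →L[ℝ] ℝ) →L[ℝ] E) : Prop where
  hasFDerivAt : ∀ l, HasFDerivAt w (ContinuousLinearMap.apply ℝ ℝ (m l)) l
  contDiff : ContDiff ℝ 1 m
  hasFDerivAt_grad : ∀ l, HasFDerivAt m (C l) l
  pos : ∀ l k : E →L[ℝ] ℝ, k ≠ 0 → 0 < k (C l k)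
  coercive : ∀ x, ∃ c : ℝ, ∀ l : E →L[ℝ] ℝ, l x - w l ≤ c - 1 / 4 * ‖l‖

namespace SteepConvex

variable {w : (E →L[ℝ] ℝ) → ℝ} {m : (E →L[ℝ] ℝ) → E}
  {C : (E →L[ℝ] ℝ) → (E →L[ℝ] ℝ) →L[ℝ] E}

theorem bddAbove (h : SteepConvex w m C) (x : E) :
    BddAbove (Set.range fun l : E →L[ℝ] ℝ => l x - w l) := by
  obtain ⟨c, hc⟩ := h.coercive x
  refine ⟨c, ?_⟩
  rintro _ ⟨l, rfl⟩
  have := norm_nonneg l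
  linarith [hc l]

/-- The gradient is strictly monotone along segments, hence injective. -/
theorem injective (h : SteepConvex w m C) : Function.Injective m := by
  intro l₁ l₂ heq
  by_contra hne
  set k := l₂ - l₁ with hk
  have hk0 : k ≠ 0 := sub_ne_zero.2 (Ne.symm hne)
  have hd : ∀ t : ℝ, HasDerivAt (fun t : ℝ => k (m (l₁ + t • k))) (k (C (l₁ + t • k) k)) t := by
    intro t
    have h1 : HasDerivAt (fun t : ℝ => l₁ + t • k) k t := by
      simpa using ((hasDerivAt_id t).smul_const k).const_add l₁
    exact k.hasFDerivAt.comp_hasDerivAt t ((h.hasFDerivAt_grad _).comp_hasDerivAt t h1)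
  have hmono : StrictMono fun t : ℝ => k (m (l₁ + t • k)) :=
    strictMono_of_deriv_pos fun t => by
      rw [(hd t).deriv]
      exact h.pos _ _ hk0
  have := hmono (zero_lt_one' ℝ)
  simp [hk, heq] at this

theorem continuous (h : SteepConvex w m C) : Continuous w :=
  continuous_iff_continuousAt.2 fun l => (h.hasFDerivAt l).continuousAt

/-- By coercivity the supremum in the Legendre transform is attained. -/
theorem exists_max (h : SteepConvex w m C) (x : E) : ∃ l, ∀ k, k x - w k ≤ l x - w l := by
  have : ProperSpace (E →L[ℝ] ℝ) := FiniteDimensional.proper ℝ _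
  obtain ⟨c, hc⟩ := h.coercive x
  have hcont : Continuous fun l : E →L[ℝ] ℝ => l x - w l :=
    ((ContinuousLinearMap.apply ℝ ℝ x).continuous).sub h.continuous
  refine hcont.exists_forall_ge' 0 ?_
  have hev : ∀ᶠ l : E →L[ℝ] ℝ in cocompact _, 4 * (c + w 0) ≤ ‖l‖ :=
    (tendsto_norm_cocompact_atTop).eventually_ge_atTop _
  filter_upwards [hev] with l hl
  have := hc l
  simp
  linarith

/-- A maximizer of `l x - w l` is a source whose gradient is `x`. -/
theorem grad_eq_of_max (h : SteepConvex w m C) {x : E} {l : E →L[ℝ] ℝ}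
    (hl : ∀ k, k x - w k ≤ l x - w l) : m l = x := by
  have hd : HasFDerivAt (fun l : E →L[ℝ] ℝ => l x - w l)
      (ContinuousLinearMap.apply ℝ ℝ x - ContinuousLinearMap.apply ℝ ℝ (m l)) l :=
    (ContinuousLinearMap.apply ℝ ℝ x).hasFDerivAt.sub (h.hasFDerivAt l)
  have hmax : IsLocalMax (fun l : E →L[ℝ] ℝ => l x - w l) l := Eventually.of_forall hl
  have h0 := hmax.hasFDerivAt_eq_zero hd
  refine (sub_eq_zero.1 ?_).symm
  by_contra hne
  obtain ⟨g, -, hg⟩ := exists_dual_vector ℝ (x - m l) (norm_ne_zero_iff.2 hne)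
  have := congrArg (fun A => A g) h0
  simp only [sub_apply, ContinuousLinearMap.apply_apply, zero_apply] at this
  rw [← map_sub, hg] at this
  exact hne (norm_eq_zero.1 (by exact_mod_cast this))

end SteepConvex

/-- The source at which the gradient `m` takes the value `x`: the unique one if `m` is the gradient
of a function as in `SteepConvex`, and a junk value if `m` does not take the value `x`. -/
noncomputable def source (m : (E →L[ℝ] ℝ) → E) (x : E) : E →L[ℝ] ℝ := Function.invFun m x

namespace SteepConvex

variable {w : (E →L[ℝ] ℝ) → ℝ} {m : (E →L[ℝ] ℝ) → E}
  {C : (E →L[ℝ] ℝ) → (E →L[ℝ] ℝ) →L[ℝ] E}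

theorem grad_source (h : SteepConvex w m C) (x : E) : m (source m x) = x := by
  obtain ⟨l, hl⟩ := h.exists_max x
  exact Function.invFun_eq ⟨l, h.grad_eq_of_max hl⟩

theorem source_grad (h : SteepConvex w m C) (l : E →L[ℝ] ℝ) : source m (m l) = l :=
  h.injective (h.grad_source _)

theorem le_source (h : SteepConvex w m C) (x : E) (k : E →L[ℝ] ℝ) :
    k x - w k ≤ source m x x - w (source m x) := by
  obtain ⟨l, hl⟩ := h.exists_max x
  rw [show source m x = l by rw [← h.source_grad l, h.grad_eq_of_max hl]]
  exact hl k

theorem lt_source (h : SteepConvex w m C) (x : E) {k : E →L[ℝ] ℝ} (hk : k ≠ source m x) :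
    k x - w k < source m x x - w (source m x) := by
  refine lt_of_le_of_ne (h.le_source x k) fun heq => hk ?_
  rw [← h.grad_eq_of_max (x := x) (l := k) fun k' => heq ▸ h.le_source x k', h.source_grad]

theorem iSup_eq (h : SteepConvex w m C) (x : E) :
    ⨆ l : E →L[ℝ] ℝ, (l x - w l) = source m x x - w (source m x) :=
  le_antisymm (ciSup_le (h.le_source x)) (le_ciSup (h.bddAbove x) (source m x))

/-- The positive definite Hessian as an isomorphism of the dual space with the space. -/
noncomputable def hessEquiv (h : SteepConvex w m C) (l : E →L[ℝ] ℝ) : (E →L[ℝ] ℝ) ≃L[ℝ] E :=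
  (LinearEquiv.ofInjectiveOfFinrankEq (C l).toLinearMap (by
    refine (injective_iff_map_eq_zero _).2 fun k hk => ?_
    by_contra hne
    have := h.pos l k hne
    rw [ContinuousLinearMap.coe_coe] at hk
    rw [hk, map_zero] at this
    exact lt_irrefl _ this) finrank_strongDual).toContinuousLinearEquiv

theorem coe_hessEquiv (h : SteepConvex w m C) (l : E →L[ℝ] ℝ) :
    (h.hessEquiv l : (E →L[ℝ] ℝ) →L[ℝ] E) = C l := by
  ext k
  rfl

theorem contDiffAt_source_hasFDerivAt (h : SteepConvex w m C) (x : E) :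
    ContDiffAt ℝ 1 (source m) x ∧
      HasFDerivAt (source m) ((h.hessEquiv (source m x)).symm : E →L[ℝ] (E →L[ℝ] ℝ)) x := by
  have hx := h.grad_source x
  set l := source m x with hl
  have hcd : ContDiffAt ℝ 1 m l := h.contDiff.contDiffAt
  have hf : HasFDerivAt m (h.hessEquiv l : (E →L[ℝ] ℝ) →L[ℝ] E) l := by
    rw [h.coe_hessEquiv]
    exact h.hasFDerivAt_grad l
  have hs := hcd.hasStrictFDerivAt' hf one_ne_zero
  have hcd' := hcd.to_localInverse hf one_ne_zero
  have hs' := hs.to_localInverse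
  rw [hx] at hcd' hs'
  have heq : source m =ᶠ[𝓝 x] hs.localInverse m (h.hessEquiv l) l := by
    rw [← hx]
    exact hs.localInverse_unique (Eventually.of_forall h.source_grad)
  exact ⟨hcd'.congr_of_eventuallyEq heq, hs'.hasFDerivAt.congr_of_eventuallyEq heq⟩

theorem contDiff_source (h : SteepConvex w m C) : ContDiff ℝ 1 (source m) :=
  contDiff_iff_contDiffAt.2 fun x => (h.contDiffAt_source_hasFDerivAt x).1

/-- The derivative of the source inverts the Hessian. -/
theorem hess_fderiv_source (h : SteepConvex w m C) (x v : E) :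
    C (source m x) (fderiv ℝ (source m) x v) = v := by
  rw [(h.contDiffAt_source_hasFDerivAt x).2.fderiv, ← h.coe_hessEquiv]
  simp

/-- The source is the gradient of the Legendre transform. -/
theorem hasFDerivAt_legendre (h : SteepConvex w m C) (x : E) :
    HasFDerivAt (fun x => ⨆ l : E →L[ℝ] ℝ, (l x - w l)) (source m x) x := by
  rw [funext h.iSup_eq]
  have hj := (h.contDiffAt_source_hasFDerivAt x).2
  refine ((hj.clm_apply (hasFDerivAt_id x)).sub
    ((h.hasFDerivAt (source m x)).comp x hj)).congr_fderiv ?_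
  ext v
  simp [h.grad_source x]

theorem fderiv_legendre (h : SteepConvex w m C) :
    fderiv ℝ (fun x => ⨆ l : E →L[ℝ] ℝ, (l x - w l)) = source m :=
  funext fun x => (h.hasFDerivAt_legendre x).fderiv

theorem contDiff_legendre (h : SteepConvex w m C) :
    ContDiff ℝ 2 (fun x => ⨆ l : E →L[ℝ] ℝ, (l x - w l)) := by
  rw [show (2 : WithTop ℕ∞) = 1 + 1 by norm_num, contDiff_succ_iff_fderiv]
  refine ⟨fun x => (h.hasFDerivAt_legendre x).differentiableAt, by simp, ?_⟩
  rw [h.fderiv_legendre]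
  exact h.contDiff_source

end SteepConvex

theorem Confining.steepConvex [MeasurableSpace E] [BorelSpace E] {μ : Measure E}
    [μ.IsAddHaarMeasure] {s : E → ℝ} (hs : Confining μ s) :
    SteepConvex (logZ μ s) (mean μ s) (cov μ s) where
  hasFDerivAt := hs.hasFDerivAt_logZ
  contDiff := hs.contDiff_mean
  hasFDerivAt_grad := hs.hasFDerivAt_mean
  pos := hs.cov_pos
  coercive := hs.logZ_coercive

end ExpFamily

namespace ExpFamily

open Filter Topology

variable {E : Type*} [NormedAddCommGroup E] [NormedSpace ℝ E] [FiniteDimensional ℝ E]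
  [MeasurableSpace E] [BorelSpace E] {μ : Measure E} {K : Type*} [Fintype K]

/-! ### Perturbed actions and the envelope theorem -/

/-- The expectation of the increment of the action bounds the change of `logZ` (Jensen's
inequality). -/
theorem Confining.logZ_sub_avg_le [μ.IsAddHaarMeasure] {s s' d : E → ℝ} (hs : Confining μ s)
    (hs' : Confining μ s') (hd : ExpBounded d) (h : ∀ x, s' x = s x + d x) (l : E →L[ℝ] ℝ) :
    logZ μ s l - avg μ s l d ≤ logZ μ s' l := by
  set a := avg μ s l d with ha
  have hZ := hs.Z_pos l
  have h1 : ExpBounded fun x => (1 + a) + (-1) * d x :=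
    (expBounded_const _).add ((expBounded_const (-1 : ℝ)).mul hd)
  have hlow : avg μ s l (fun x => (1 + a) + (-1) * d x) = 1 := by
    rw [hs.avg_add (expBounded_const _) ((expBounded_const (-1 : ℝ)).mul hd), hs.avg_const]
    have := hs.clm_avg hd ((-1 : ℝ) • (1 : ℝ →L[ℝ] ℝ)) l
    simp only [smul_apply, one_apply_eq_self, smul_eq_mul] at this
    rw [← this, ← ha]
    ring
  have hmom : moment μ s (fun x => (1 + a) + (-1) * d x) l = moment μ s (fun _ => (1 : ℝ)) l := by
    rw [avg, smul_eq_mul, inv_mul_eq_one₀ hZ.ne'] at hlow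
    exact hlow.symm
  have hle : Real.exp (-a) * moment μ s (fun _ => (1 : ℝ)) l ≤
      moment μ s' (fun _ => (1 : ℝ)) l := by
    rw [← hmom, moment, ← integral_const_mul]
    refine integral_mono ((hs.integrable_smul h1 l).const_mul _)
      (hs'.integrable_smul (expBounded_const 1) l) fun x => ?_
    -- the tangent of the exponential at the mean of `d`
    have h2 : (1 + a) + (-1) * d x ≤ Real.exp (a - d x) := by
      have := Real.add_one_le_exp (a - d x)
      linarith
    calc Real.exp (-a) * (Real.exp (-s x + l x) • ((1 + a) + (-1) * d x))
        ≤ Real.exp (-a) * (Real.exp (-s x + l x) * Real.exp (a - d x)) := by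
          rw [smul_eq_mul]
          gcongr
      _ = Real.exp (-s' x + l x) • (1 : ℝ) := by
          rw [smul_eq_mul, mul_one, ← Real.exp_add, ← Real.exp_add, h]
          ring_nf
  have hlog := Real.log_le_log (by positivity) hle
  rw [Real.log_mul (Real.exp_pos _).ne' hZ.ne', Real.log_exp] at hlog
  rw [logZ_eq, logZ_eq]
  linarith

theorem Confining.logZ_anti [μ.IsAddHaarMeasure] {s s' : E → ℝ} (hs : Confining μ s)
    (hs' : Confining μ s') (h : ∀ x, s x ≤ s' x) (l : E →L[ℝ] ℝ) : logZ μ s' l ≤ logZ μ s l := by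
  rw [logZ_eq, logZ_eq]
  refine Real.log_le_log (hs'.Z_pos l) ?_
  refine integral_mono (hs'.integrable_smul (expBounded_const 1) l)
    (hs.integrable_smul (expBounded_const 1) l) fun x => ?_
  have := h x
  simp only [smul_eq_mul, mul_one]
  gcongr

theorem Confining.avg_finsetSum {F : Type*} [NormedAddCommGroup F] [NormedSpace ℝ F]
    {s : E → ℝ} (hs : Confining μ s)
    {f : K → E → F} (hf : ∀ k, ExpBounded (f k)) (l : E →L[ℝ] ℝ) (u : Finset K) :
    avg μ s l (fun x => ∑ k ∈ u, f k x) = ∑ k ∈ u, avg μ s l (f k) := by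
  classical
  induction u using Finset.induction_on with
  | empty => simp [avg, moment]
  | insert k u hk ih =>
    simp only [Finset.sum_insert hk]
    rw [hs.avg_add (hf k) (ExpBounded.finsetSum hf u), ih]

/-- The action `s + ∑ k, c k * f k`. -/
def perturb (s : E → ℝ) (f : K → E → ℝ) (c : K → ℝ) (x : E) : ℝ := s x + ∑ k, c k * f k x

theorem expBounded_sum_mul {f : K → E → ℝ} (hf : ∀ k, ExpBounded (f k)) (c : K → ℝ) :
    ExpBounded fun x => ∑ k, c k * f k x :=
  ExpBounded.finsetSum (fun k => (expBounded_const (c k)).mul (hf k)) _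

theorem Confining.avg_sum_mul {s : E → ℝ} (hs : Confining μ s)
    {f : K → E → ℝ} (hf : ∀ k, ExpBounded (f k)) (l : E →L[ℝ] ℝ) (c : K → ℝ) :
    avg μ s l (fun x => ∑ k, c k * f k x) = ∑ k, c k * avg μ s l (f k) := by
  rw [hs.avg_finsetSum (fun k => (expBounded_const (c k)).mul (hf k))]
  refine Finset.sum_congr rfl fun k _ => ?_
  exact (hs.clm_avg (hf k) (c k • (1 : ℝ →L[ℝ] ℝ)) l).symm

theorem Confining.perturbed {s : E → ℝ} (hs : Confining μ s) {f : K → E → ℝ}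
    (hf : ∀ k, ExpBounded (f k)) (hf0 : ∀ k x, 0 ≤ f k x) {c : K → ℝ} (hc : ∀ k, 0 ≤ c k) :
    Confining μ (perturb s f c) := by
  have hcont : Continuous (perturb s f c) :=
    hs.continuous.add (expBounded_sum_mul hf c).1
  refine ⟨hcont, fun a => (hs.integrable a).mono' ?_ (Eventually.of_forall fun x => ?_)⟩
  · exact (by fun_prop : Continuous fun x =>
      Real.exp (a * ‖x‖ - perturb s f c x)).aestronglyMeasurable
  · rw [Real.norm_eq_abs, Real.abs_exp]
    have : 0 ≤ ∑ k, c k * f k x := Finset.sum_nonneg fun k _ => mul_nonneg (hc k) (hf0 k x)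
    apply Real.exp_le_exp.2
    rw [perturb]
    linarith

theorem abs_sum_mul_sub_le (ρ a b : K → ℝ) {ε : ℝ} (h : ∀ k, |b k - a k| ≤ ε) :
    |∑ k, ρ k * b k - ∑ k, ρ k * a k| ≤ ε * ∑ k, |ρ k| := by
  rw [← Finset.sum_sub_distrib, Finset.mul_sum]
  refine (Finset.abs_sum_le_sum_abs _ _).trans (Finset.sum_le_sum fun k _ => ?_)
  rw [← mul_sub, abs_mul, mul_comm]
  exact mul_le_mul_of_nonneg_right (h k) (abs_nonneg _)

section Scale

variable {s : E → ℝ} {f : K → E → ℝ} {r : ℝ → K → ℝ} {S : Set ℝ} {t₀ : ℝ}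

/-- Expectations are continuous along a family of nonnegative perturbations, by dominated
convergence with respect to the unperturbed weight. -/
theorem Confining.tendsto_avg_perturb [μ.IsAddHaarMeasure] (hs : Confining μ s)
    (hf : ∀ k, ExpBounded (f k)) (hf0 : ∀ k x, 0 ≤ f k x) (ht₀ : t₀ ∈ S)
    (hr : ∀ t ∈ S, ∀ k, 0 ≤ r t k) (hrc : ∀ k, ContinuousWithinAt (fun t => r t k) S t₀)
    {g : E → ℝ} (hg : ExpBounded g) (l : E →L[ℝ] ℝ) :
    Tendsto (fun t => avg μ (perturb s f (r t)) l g) (𝓝[S] t₀)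
      (𝓝 (avg μ (perturb s f (r t₀)) l g)) := by
  have key : ∀ {g : E → ℝ}, ExpBounded g →
      Tendsto (fun t => moment μ (perturb s f (r t)) g l) (𝓝[S] t₀)
        (𝓝 (moment μ (perturb s f (r t₀)) g l)) := by
    intro g hg
    refine tendsto_integral_filter_of_dominated_convergence
      (fun x => ‖Real.exp (-s x + l x) • g x‖) ?_ ?_ (hs.integrable_smul hg l).norm
      (Eventually.of_forall fun x => ?_)
    · filter_upwards [self_mem_nhdsWithin] with t ht
      exact ((hs.perturbed hf hf0 (hr t ht)).integrable_smul hg l).aestronglyMeasurable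
    · filter_upwards [self_mem_nhdsWithin] with t ht
      refine Eventually.of_forall fun x => ?_
      rw [norm_exp_smul, norm_exp_smul]
      have : 0 ≤ ∑ k, r t k * f k x :=
        Finset.sum_nonneg fun k _ => mul_nonneg (hr t ht k) (hf0 k x)
      refine mul_le_mul_of_nonneg_right (Real.exp_le_exp.2 ?_) (norm_nonneg _)
      rw [perturb]
      linarith
    · have hp : Tendsto (fun t => perturb s f (r t) x) (𝓝[S] t₀) (𝓝 (perturb s f (r t₀) x)) :=
        tendsto_const_nhds.add (tendsto_finsetSum _ fun k _ => (hrc k).tendsto.mul_const _)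
      exact ((Real.continuous_exp.tendsto _).comp (hp.neg.add_const _)).smul_const _
  exact ((key (expBounded_const 1)).inv₀ ((hs.perturbed hf hf0 (hr t₀ ht₀)).Z_pos l).ne').smul
    (key hg)

/-- Away from its maximizer, the Legendre functional at `t₀` stays below its maximum; together with
uniform coercivity this localizes the supremum for `t` near `t₀`. -/
theorem Confining.eventually_legendre_le [μ.IsAddHaarMeasure] (hs : Confining μ s)
    (hf : ∀ k, ExpBounded (f k)) (hf0 : ∀ k x, 0 ≤ f k x) (ht₀ : t₀ ∈ S)
    (hr : ∀ t ∈ S, ∀ k, 0 ≤ r t k) (hrc : ∀ k, ContinuousWithinAt (fun t => r t k) S t₀)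
    (x : E) {l₀ : E →L[ℝ] ℝ} (hl₀ : l₀ = source (mean μ (perturb s f (r t₀))) x)
    {ε : ℝ} (hε : 0 < ε) :
    ∀ᶠ t in 𝓝[S] t₀, ∀ l : E →L[ℝ] ℝ, l x - logZ μ (perturb s f (r t)) l ≤
      (l₀ x - logZ μ (perturb s f (r t₀)) l₀) +
        ∑ k, (r t k - r t₀ k) * avg μ (perturb s f (r t₀)) l₀ (f k) +
        ε * ∑ k, |r t k - r t₀ k| := by
  have : ProperSpace (E →L[ℝ] ℝ) := FiniteDimensional.proper ℝ _
  set s₀ := perturb s f (r t₀) with hs₀def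
  have hs₀ : Confining μ s₀ := hs.perturbed hf hf0 (hr t₀ ht₀)
  set U₀ := l₀ x - logZ μ s₀ l₀ with hU₀
  set A : K → (E →L[ℝ] ℝ) → ℝ := fun k l => avg μ s₀ l (f k) with hA
  have hAc : ∀ k, Continuous (A k) := fun k => hs₀.continuous_avg (hf k)
  have hstep : ∀ t ∈ S, ∀ l : E →L[ℝ] ℝ, l x - logZ μ (perturb s f (r t)) l ≤
      (l x - logZ μ s₀ l) + ∑ k, (r t k - r t₀ k) * A k l := by
    intro t ht l
    have h := hs₀.logZ_sub_avg_le (hs.perturbed hf hf0 (hr t ht))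
      (expBounded_sum_mul hf fun k => r t k - r t₀ k) (fun y => by
        simp only [hs₀def, perturb, sub_mul, Finset.sum_sub_distrib]
        ring) l
    rw [hs₀.avg_sum_mul hf] at h
    linarith
  -- uniform coercivity, from a perturbation that dominates all those near `t₀`
  have hs₁ : Confining μ (perturb s f fun k => r t₀ k + 1) :=
    hs.perturbed hf hf0 fun k => add_nonneg (hr t₀ ht₀ k) zero_le_one
  obtain ⟨c, hc⟩ := hs₁.logZ_coercive x
  -- the neighbourhood of the maximizer where the expectations vary little, and its complement
  set O : Set (E →L[ℝ] ℝ) := {l | ∀ k, |A k l - A k l₀| < ε} with hO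
  have hOopen : IsOpen O := by
    rw [hO, Set.ofPred_forall]
    exact isOpen_iInter_of_finite fun k =>
      isOpen_lt ((hAc k).sub continuous_const).abs continuous_const
  set R := 4 * (c - U₀ + 1) with hR
  have hKc : IsCompact (Metric.closedBall (0 : E →L[ℝ] ℝ) R \ O) :=
    (isCompact_closedBall _ _).diff hOopen
  have hgc : Continuous fun l : E →L[ℝ] ℝ => l x - logZ μ s₀ l :=
    ((ContinuousLinearMap.apply ℝ ℝ x).continuous).sub hs₀.steepConvex.continuous
  obtain ⟨δ, hδ, hgap⟩ : ∃ δ > 0, ∀ l ∈ Metric.closedBall (0 : E →L[ℝ] ℝ) R \ O,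
      l x - logZ μ s₀ l ≤ U₀ - δ := by
    rcases (Metric.closedBall (0 : E →L[ℝ] ℝ) R \ O).eq_empty_or_nonempty with he | hne
    · exact ⟨1, one_pos, by simp [he]⟩
    · obtain ⟨l₁, hl₁, hmax⟩ := hKc.exists_isMaxOn hne hgc.continuousOn
      refine ⟨U₀ - (l₁ x - logZ μ s₀ l₁), ?_, fun l hl => ?_⟩
      · have hne' : l₁ ≠ l₀ := by
          rintro rfl
          exact hl₁.2 fun k => by simpa using hε
        have := hs₀.steepConvex.lt_source x (k := l₁) (hl₀ ▸ hne')
        rw [← hl₀] at this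
        linarith
      · have : l x - logZ μ s₀ l ≤ l₁ x - logZ μ s₀ l₁ := hmax hl
        linarith
  have hMex : ∀ k, ∃ M, ∀ l ∈ Metric.closedBall (0 : E →L[ℝ] ℝ) R, |A k l| ≤ M := by
    intro k
    obtain ⟨M, hM⟩ := (isCompact_closedBall (0 : E →L[ℝ] ℝ) R).bddAbove_image
      (hAc k).abs.continuousOn
    exact ⟨M, fun l hl => hM ⟨l, hl, rfl⟩⟩
  choose M hM using hMex
  have hρ : ∀ k, Tendsto (fun t => r t k - r t₀ k) (𝓝[S] t₀) (𝓝 0) := fun k => by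
    simpa using (hrc k).tendsto.sub_const (r t₀ k)
  have hρabs : ∀ k, Tendsto (fun t => |r t k - r t₀ k|) (𝓝[S] t₀) (𝓝 0) := fun k => by
    simpa using (hρ k).abs
  have hφ : Tendsto (fun t => ∑ k, (r t k - r t₀ k) * A k l₀ + ε * ∑ k, |r t k - r t₀ k|)
      (𝓝[S] t₀) (𝓝 0) := by
    simpa using (tendsto_finsetSum Finset.univ fun k _ => (hρ k).mul_const (A k l₀)).add
      ((tendsto_finsetSum Finset.univ fun k _ => hρabs k).const_mul ε)
  have hψ : Tendsto (fun t => ∑ k, |r t k - r t₀ k| * M k) (𝓝[S] t₀) (𝓝 0) := by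
    simpa using tendsto_finsetSum Finset.univ fun k _ => (hρabs k).mul_const (M k)
  have hψφ := hψ.sub hφ
  rw [sub_zero] at hψφ
  have hle1 : ∀ᶠ t in 𝓝[S] t₀, ∀ k, r t k - r t₀ k < 1 :=
    eventually_all.2 fun k => (hρ k).eventually_lt_const one_pos
  filter_upwards [self_mem_nhdsWithin, hle1, hφ.eventually_const_lt (show (-1 : ℝ) < 0 by norm_num),
    hψφ.eventually_lt_const hδ] with t ht ht1 ht2 ht3 l
  by_cases hlR : l ∈ Metric.closedBall (0 : E →L[ℝ] ℝ) R
  · have h1 := hstep t ht l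
    by_cases hlO : l ∈ O
    · have h2 := abs_sum_mul_sub_le (fun k => r t k - r t₀ k) (fun k => A k l₀) (fun k => A k l)
        fun k => (hlO k).le
      have h3 := hs₀.steepConvex.le_source x l
      rw [← hl₀] at h3
      linarith [(abs_le.1 h2).2]
    · have h2 := hgap l ⟨hlR, hlO⟩
      have h3 : ∑ k, (r t k - r t₀ k) * A k l ≤ ∑ k, |r t k - r t₀ k| * M k := by
        refine Finset.sum_le_sum fun k _ => (le_abs_self _).trans ?_
        rw [abs_mul]
        exact mul_le_mul_of_nonneg_left (hM k l hlR) (abs_nonneg _)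
      linarith
  · have h1 : R < ‖l‖ := by simpa using hlR
    have h3 : logZ μ (perturb s f fun k => r t₀ k + 1) l ≤ logZ μ (perturb s f (r t)) l := by
      refine (hs.perturbed hf hf0 (hr t ht)).logZ_anti hs₁ (fun y => ?_) l
      refine add_le_add_right (Finset.sum_le_sum fun k _ => ?_) _
      exact mul_le_mul_of_nonneg_right (by linarith [ht1 k]) (hf0 k y)
    have h4 := hc l
    linarith

/-- Envelope theorem: the derivative of the Legendre transform along a family of perturbations is
the expectation of the derivative of the action at the maximizing source. The coefficients `r` need
only be differentiable at the one point `t₀`, within `S`. -/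
theorem Confining.hasDerivWithinAt_legendre [μ.IsAddHaarMeasure] (hs : Confining μ s)
    (hf : ∀ k, ExpBounded (f k)) (hf0 : ∀ k x, 0 ≤ f k x) (ht₀ : t₀ ∈ S)
    (hr : ∀ t ∈ S, ∀ k, 0 ≤ r t k) {dr : K → ℝ}
    (hdr : ∀ k, HasDerivWithinAt (fun t => r t k) (dr k) S t₀) (x : E) :
    HasDerivWithinAt (fun t => ⨆ l : E →L[ℝ] ℝ, (l x - logZ μ (perturb s f (r t)) l))
      (∑ k, dr k * avg μ (perturb s f (r t₀))
        (source (mean μ (perturb s f (r t₀))) x) (f k)) S t₀ := by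
  have hrc : ∀ k, ContinuousWithinAt (fun t => r t k) S t₀ := fun k => (hdr k).continuousWithinAt
  set U : ℝ → ℝ := fun t => ⨆ l : E →L[ℝ] ℝ, (l x - logZ μ (perturb s f (r t)) l) with hU
  set l₀ := source (mean μ (perturb s f (r t₀))) x with hl₀
  set a : K → ℝ := fun k => avg μ (perturb s f (r t₀)) l₀ (f k) with ha
  have hs₀ : Confining μ (perturb s f (r t₀)) := hs.perturbed hf hf0 (hr t₀ ht₀)
  have hU₀ : U t₀ = l₀ x - logZ μ (perturb s f (r t₀)) l₀ := hs₀.steepConvex.iSup_eq x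
  have hlin : HasDerivWithinAt (fun t => ∑ k, (r t k - r t₀ k) * a k) (∑ k, dr k * a k) S t₀ :=
    HasDerivWithinAt.fun_sum fun k _ => ((hdr k).sub_const _).mul_const _
  have hsmall : (fun t => U t - U t₀ - ∑ k, (r t k - r t₀ k) * a k) =o[𝓝[S] t₀]
      fun t => ∑ k, |r t k - r t₀ k| := by
    refine Asymptotics.isLittleO_iff.2 fun ε hε => ?_
    have hav : ∀ᶠ t in 𝓝[S] t₀, ∀ k, |avg μ (perturb s f (r t)) l₀ (f k) - a k| < ε := by
      refine eventually_all.2 fun k => ?_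
      have h := hs.tendsto_avg_perturb hf hf0 ht₀ hr hrc (hf k) l₀
      have h' := (h.sub_const (a k)).abs
      rw [sub_self, abs_zero] at h'
      exact h'.eventually_lt_const hε
    filter_upwards [self_mem_nhdsWithin, hav,
      hs.eventually_legendre_le hf hf0 ht₀ hr hrc x hl₀ hε] with t ht hav hup
    have hst : Confining μ (perturb s f (r t)) := hs.perturbed hf hf0 (hr t ht)
    have hnn : 0 ≤ ∑ k, |r t k - r t₀ k| := Finset.sum_nonneg fun k _ => abs_nonneg _
    rw [Real.norm_eq_abs, Real.norm_eq_abs, abs_of_nonneg hnn, abs_le]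
    constructor
    -- lower bound: the maximizer at `t₀` as a competitor, and Jensen's inequality from `t` to `t₀`
    · have h1 : l₀ x - logZ μ (perturb s f (r t)) l₀ ≤ U t :=
        le_ciSup (hst.steepConvex.bddAbove x) l₀
      have h2 := hst.logZ_sub_avg_le hs₀ (expBounded_sum_mul hf fun k => -(r t k - r t₀ k))
        (fun y => by
          simp only [perturb, neg_mul, sub_mul, Finset.sum_neg_distrib,
            Finset.sum_sub_distrib]
          ring) l₀
      rw [hst.avg_sum_mul hf] at h2
      simp only [neg_mul, Finset.sum_neg_distrib] at h2
      have h3 := abs_sum_mul_sub_le (fun k => r t k - r t₀ k) a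
        (fun k => avg μ (perturb s f (r t)) l₀ (f k)) fun k => (hav k).le
      linarith [(abs_le.1 h3).1]
    · have h1 : U t ≤ _ := ciSup_le hup
      linarith
  have hbig : (fun t => ∑ k, |r t k - r t₀ k|) =O[𝓝[S] t₀] fun t => t - t₀ := by
    refine Asymptotics.IsBigO.fun_sum fun k _ => ?_
    exact (hdr k).hasFDerivWithinAt.isBigO_sub.norm_left
  have hrest : HasDerivWithinAt (fun t => U t - U t₀ - ∑ k, (r t k - r t₀ k) * a k) 0 S t₀ := by
    rw [hasDerivWithinAt_iff_isLittleO]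
    simpa using hsmall.trans_isBigO hbig
  have := (hrest.add hlin).add_const (U t₀)
  rw [zero_add] at this
  refine this.congr_of_mem (fun t _ => ?_) ht₀
  simp

end Scale

end ExpFamily

namespace MatrixFRG

variable {ι : Type*} [Fintype ι] [DecidableEq ι]

/-! ### The norm on the space of fields -/

/-- The distance of the sup norm on the fields, with the topology, by definition, that of a
subspace of tuples of matrices. -/
@[reducible] noncomputable def fieldsMetric (L : ℕ) (e : ι → ℤˣ) (T : Finset ι) :
    MetricSpace (fields L e T) :=
  (inferInstance : NormedAddCommGroup (fields L e T)).toMetricSpace.replaceTopology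
    (U := instTopologicalSpaceSubtype) rfl

/-- The sup norm on the fields. It agrees with the norm of the subspace of tuples of matrices, but
its topology and its group structure are those found by instance search without a norm. -/
@[reducible] noncomputable def fieldsNormed (L : ℕ) (e : ι → ℤˣ) (T : Finset ι) :
    NormedAddCommGroup (fields L e T) :=
  { Submodule.addCommGroup (fields L e T), fieldsMetric L e T with
    norm := fun X => ‖X‖
    dist_eq := (inferInstance : NormedAddCommGroup (fields L e T)).dist_eq }

/-- The seminorm underlying `fieldsNormed`. -/
@[reducible] noncomputable def fieldsSeminormed (L : ℕ) (e : ι → ℤˣ) (T : Finset ι) :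
    SeminormedAddCommGroup (fields L e T) :=
  (fieldsNormed L e T).toSeminormedAddCommGroup

section
attribute [local instance] fieldsNormed fieldsSeminormed

/-- The fields as a normed space over `ℝ` with the norm `fieldsNormed`. -/
@[reducible] noncomputable def fieldsNormedSpace (L : ℕ) (e : ι → ℤˣ) (T : Finset ι) :
    NormedSpace ℝ (fields L e T) :=
  { Submodule.module (fields L e T) with
    norm_smul_le := fun c X => norm_smul_le c (X : ι → Matrix (Fin L) (Fin L) ℂ) }
end

end MatrixFRG

namespace ExpFamily

variable {E : Type*} [NormedAddCommGroup E] [NormedSpace ℝ E] [FiniteDimensional ℝ E]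
  [MeasurableSpace E] [BorelSpace E] {μ : Measure E} {s : E → ℝ}

/-! ### Covariances of complex-valued functions -/

/-- The covariance, without complex conjugation, of two complex-valued real-linear functions. -/
noncomputable def complexCov (μ : Measure E) (s : E → ℝ) (l : E →L[ℝ] ℝ) (A B : E →L[ℝ] ℂ) : ℂ :=
  avg μ s l (fun x => A x * B x) - A (mean μ s l) * B (mean μ s l)

/-- If the real form `k` is a complex combination of the functions `A p`, then the covariance of
`k` with `B` is the corresponding combination of complex covariances. -/
theorem Confining.clm_cov_eq_sum {P : Type*} [Fintype P] (hs : Confining μ s) (l k : E →L[ℝ] ℝ)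
    (B : E →L[ℝ] ℂ) (A : P → E →L[ℝ] ℂ) (c : P → ℂ) (h : ∀ x, (k x : ℂ) = ∑ p, c p * A p x) :
    B (cov μ s l k) = ∑ p, c p * complexCov μ s l (A p) B := by
  rw [hs.clm_cov_apply]
  have hAB : ∀ p, ExpBounded fun x => A p x * B x := fun p =>
    (expBounded_clm (A p)).mul (expBounded_clm B)
  have hfun : (fun x => k x • B x) = fun x => ∑ p, c p * (A p x * B x) := by
    funext x
    rw [Complex.real_smul, h, Finset.sum_mul]
    exact Finset.sum_congr rfl fun p _ => mul_assoc _ _ _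
  have hmul : ∀ p, avg μ s l (fun x => c p * (A p x * B x)) =
      c p * avg μ s l (fun x => A p x * B x) := fun p =>
    (hs.clm_avg (hAB p) (ContinuousLinearMap.mul ℝ ℂ (c p)) l).symm
  rw [hfun, hs.avg_finsetSum (fun p => (expBounded_const (c p)).mul (hAB p)), Complex.real_smul, h,
    Finset.sum_mul, ← Finset.sum_sub_distrib]
  refine Finset.sum_congr rfl fun p _ => ?_
  rw [hmul, complexCov]
  ring

theorem complexCov_comm (μ : Measure E) (s : E → ℝ) (l : E →L[ℝ] ℝ) (A B : E →L[ℝ] ℂ) :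
    complexCov μ s l A B = complexCov μ s l B A := by
  simp only [complexCov, mul_comm]

theorem Confining.sum_complexCov_eq_zero {P : Type*} [Fintype P] (hs : Confining μ s)
    (l : E →L[ℝ] ℝ) (B : E →L[ℝ] ℂ) (A : P → E →L[ℝ] ℂ) (h : ∀ x, ∑ p, A p x = 0) :
    ∑ p, complexCov μ s l (A p) B = 0 := by
  have := hs.clm_cov_eq_sum l 0 B A (fun _ => 1) (fun x => by simp [h])
  simpa using this.symm

end ExpFamily

namespace MatrixFRG

open ExpFamily

section Model

attribute [local instance] fieldsNormed fieldsSeminormed fieldsNormedSpace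

variable {ι : Type*} [Fintype ι] [DecidableEq ι] {L : ℕ} {e : ι → ℤˣ} {T : Finset ι}

theorem sign_mul_self (e : ι → ℤˣ) (i : ι) : ((e i : ℤ) : ℂ) * ((e i : ℤ) : ℂ) = 1 := by
  rcases Int.units_eq_one_or (e i) with h | h <;> simp [h]

/-- Entrywise form of the condition `X_i^* = e_i X_i`. -/
theorem conj_entry (X : fields L e T) (i : ι) (a b : Fin L) :
    (starRingEnd ℂ) (X.1 i a b) = ((e i : ℤ) : ℂ) * X.1 i b a := by
  have := congrFun (congrFun (X.2.1 i) b) a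
  simpa [Matrix.conjTranspose_apply] using this

theorem sign_mul_entry (X : fields L e T) (i : ι) (a b : Fin L) :
    ((e i : ℤ) : ℂ) * X.1 i b a * X.1 i a b = (Complex.normSq (X.1 i a b) : ℂ) := by
  rw [← conj_entry, Complex.normSq_eq_conj_mul_self]

/-! ### Coordinates and complex-linear extension -/

theorem traceProj_add (i : ι) (E F : Matrix (Fin L) (Fin L) ℂ) :
    traceProj T i (E + F) = traceProj T i E + traceProj T i F := by
  by_cases h : i ∈ T
  · simp only [traceProj, h, if_true, Matrix.trace_add, mul_add, add_smul]
    abel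
  · simp [traceProj, h]

theorem traceProj_smul (i : ι) (z : ℂ) (E : Matrix (Fin L) (Fin L) ℂ) :
    traceProj T i (z • E) = z • traceProj T i E := by
  by_cases h : i ∈ T
  · simp only [traceProj, h, if_true, Matrix.trace_smul, smul_sub, smul_smul, smul_eq_mul]
    congr 2
    ring
  · simp [traceProj, h]

theorem traceProj_of_trace {i : ι} {E : Matrix (Fin L) (Fin L) ℂ} (h : i ∈ T → E.trace = 0) :
    traceProj T i E = E := by
  by_cases hi : i ∈ T
  · simp [traceProj, hi, h hi]
  · simp [traceProj, hi]

theorem fieldPart_apply_same (i : ι) (E : Matrix (Fin L) (Fin L) ℂ) :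
    (fieldPart e T i E).1 i = (1 / 2 : ℂ) • (traceProj T i E +
      ((e i : ℤ) : ℂ) • (traceProj T i E).conjTranspose) := by
  simp [fieldPart]

theorem fieldPart_apply_ne {i j : ι} (h : j ≠ i) (E : Matrix (Fin L) (Fin L) ℂ) :
    (fieldPart e T i E).1 j = 0 := by
  simp [fieldPart, h]

theorem fieldPart_add (i : ι) (E F : Matrix (Fin L) (Fin L) ℂ) :
    fieldPart e T i (E + F) = fieldPart e T i E + fieldPart e T i F := by
  ext j : 2
  by_cases h : j = i
  · subst h
    rw [Submodule.coe_add, Pi.add_apply, fieldPart_apply_same, fieldPart_apply_same,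
      fieldPart_apply_same, traceProj_add, Matrix.conjTranspose_add]
    simp only [smul_add]
    abel
  · simp [fieldPart_apply_ne h]

theorem fieldPart_smul (i : ι) (x : ℝ) (E : Matrix (Fin L) (Fin L) ℂ) :
    fieldPart e T i ((x : ℂ) • E) = x • fieldPart e T i E := by
  ext j a b
  by_cases h : j = i
  · subst h
    rw [Submodule.coe_smul, Pi.smul_apply, fieldPart_apply_same, fieldPart_apply_same,
      traceProj_smul]
    simp
    ring
  · simp [fieldPart_apply_ne h]

/-- The complex-linear extension of a real-linear map `k` to all complex directions, evaluated in
the direction of the matrix `E` (its traceless part if `i ∈ T`) in the `i`-th slot. -/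
noncomputable def complexExt (k : fields L e T →ₗ[ℝ] ℂ) (i : ι) :
    Matrix (Fin L) (Fin L) ℂ →ₗ[ℂ] ℂ where
  toFun E := k (fieldPart e T i E) + Complex.I * k (fieldPart e T i ((-Complex.I) • E))
  map_add' E F := by
    simp only [smul_add, fieldPart_add, map_add]
    ring
  map_smul' z E := by
    have h1 : z • E = (z.re : ℂ) • E + ((-z.im : ℝ) : ℂ) • ((-Complex.I) • E) := by
      conv_lhs => rw [← Complex.re_add_im z]
      rw [add_smul, smul_smul]
      congr 2
      push_cast
      ring
    have h2 : (-Complex.I) • z • E = (z.im : ℂ) • E + (z.re : ℂ) • ((-Complex.I) • E) := by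
      conv_lhs => rw [← Complex.re_add_im z]
      rw [smul_smul, smul_smul, ← add_smul]
      congr 1
      linear_combination (-(z.im : ℂ)) * Complex.I_mul_I
    rw [h2, h1]
    simp only [fieldPart_add, fieldPart_smul, map_add, map_smul, RingHom.id_apply, smul_eq_mul,
      Complex.real_smul]
    conv_rhs => rw [← Complex.re_add_im z]
    push_cast
    linear_combination (-(z.im : ℂ)) * k (fieldPart e T i ((-Complex.I) • E)) * Complex.I_mul_I

theorem complexExt_apply (k : fields L e T →ₗ[ℝ] ℂ) (i : ι) (E : Matrix (Fin L) (Fin L) ℂ) :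
    complexExt k i E =
      k (fieldPart e T i E) + Complex.I * k (fieldPart e T i ((-Complex.I) • E)) := rfl

/-- The matrix entry `(X_i)_{ab}` as a continuous real-linear function on the fields. -/
noncomputable def coord (e : ι → ℤˣ) (T : Finset ι) (i : ι) (a b : Fin L) : fields L e T →L[ℝ] ℂ :=
  LinearMap.toContinuousLinearMap
    { toFun := fun X => X.1 i a b
      map_add' := fun _ _ => rfl
      map_smul' := fun _ _ => rfl }

@[simp] theorem coord_apply (i : ι) (a b : Fin L) (X : fields L e T) :
    coord e T i a b X = X.1 i a b := rfl

theorem complexExt_coord (i k : ι) (c d : Fin L) (E : Matrix (Fin L) (Fin L) ℂ) :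
    complexExt (coord e T k c d).toLinearMap i E = if k = i then traceProj T i E c d else 0 := by
  rw [complexExt_apply]
  simp only [ContinuousLinearMap.coe_coe, coord_apply]
  by_cases h : k = i
  · subst h
    rw [fieldPart_apply_same, fieldPart_apply_same, traceProj_smul]
    simp [Matrix.conjTranspose_apply]
    linear_combination (-(1 / 2) * traceProj T k E c d + (1 / 2) * ((e k : ℤ) : ℂ) *
      (starRingEnd ℂ) (traceProj T k E d c)) * Complex.I_mul_I
  · simp [fieldPart_apply_ne h, h]

theorem fieldPart_field_same (X : fields L e T) (i : ι) :
    (fieldPart e T i (X.1 i)).1 i = X.1 i := by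
  rw [fieldPart_apply_same, traceProj_of_trace fun hi => X.2.2 i hi, X.2.1 i, smul_smul,
    sign_mul_self, one_smul, ← two_smul ℂ, smul_smul]
  norm_num

theorem fieldPart_imaginary (X : fields L e T) (i : ι) :
    fieldPart e T i ((-Complex.I) • X.1 i) = 0 := by
  ext j a b
  by_cases h : j = i
  · subst h
    rw [fieldPart_apply_same, traceProj_smul, traceProj_of_trace fun hi => X.2.2 j hi,
      Matrix.conjTranspose_smul, X.2.1 j]
    simp
    linear_combination Complex.I * X.1 j a b * sign_mul_self e j
  · simp [fieldPart_apply_ne h]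

theorem sum_fieldPart (X : fields L e T) : ∑ i, fieldPart e T i (X.1 i) = X := by
  ext j : 2
  rw [AddSubmonoidClass.coe_finsetSum, Finset.sum_apply, Finset.sum_eq_single j]
  · exact fieldPart_field_same X j
  · exact fun i _ hi => fieldPart_apply_ne hi.symm _
  · simp

/-- A real-linear function of the fields is the linear combination of the matrix entries whose
coefficients are the values of its complex-linear extension at the elementary matrices. -/
theorem sum_complexExt_mul (k : fields L e T →ₗ[ℝ] ℂ) (X : fields L e T) :
    ∑ p : ι × Fin L × Fin L, complexExt k p.1 (Matrix.single p.2.1 p.2.2 1) * X.1 p.1 p.2.1 p.2.2 =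
      k X := by
  have h : ∀ i, ∑ c, ∑ d, complexExt k i (Matrix.single c d 1) * X.1 i c d =
      k (fieldPart e T i (X.1 i)) := by
    intro i
    have h1 : complexExt k i (X.1 i) = k (fieldPart e T i (X.1 i)) := by
      rw [complexExt_apply, fieldPart_imaginary]
      simp
    rw [← h1]
    conv_rhs => rw [Matrix.matrix_eq_sum_single (X.1 i)]
    simp only [map_sum]
    refine Finset.sum_congr rfl fun c _ => Finset.sum_congr rfl fun d _ => ?_
    rw [show Matrix.single c d (X.1 i c d) = (X.1 i c d) • Matrix.single c d (1 : ℂ) by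
      simp [Matrix.smul_single], map_smul, smul_eq_mul, mul_comm]
  simp only [Fintype.sum_prod_type, h]
  rw [← map_sum, sum_fieldPart]

/-! ### The second derivative in matrix coordinates -/

/-- A real-valued linear form, regarded as complex-valued. -/
noncomputable def toComplexForm (k : fields L e T →L[ℝ] ℝ) : fields L e T →ₗ[ℝ] ℂ :=
  (Complex.ofRealCLM.comp k).toLinearMap

theorem matDeriv_eq_of_hasFDerivAt {f : fields L e T → ℂ} {f' : fields L e T →L[ℝ] ℂ}
    {X : fields L e T} (h : HasFDerivAt f f' X) (i : ι) (a b : Fin L) :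
    matDeriv e T i a b f X = complexExt f'.toLinearMap i (Matrix.single b a 1) := by
  rw [matDeriv, h.fderiv]
  rfl

/-- The bilinear form `H`, complexified in its second argument. -/
noncomputable def complexExtSnd (H : fields L e T →L[ℝ] fields L e T →L[ℝ] ℝ) (j : ι)
    (E : Matrix (Fin L) (Fin L) ℂ) : fields L e T →L[ℝ] ℂ :=
  Complex.ofRealCLM.comp (H.flip (fieldPart e T j E)) +
    Complex.I • Complex.ofRealCLM.comp (H.flip (fieldPart e T j ((-Complex.I) • E)))

theorem complexExtSnd_apply (H : fields L e T →L[ℝ] fields L e T →L[ℝ] ℝ) (j : ι)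
    (E : Matrix (Fin L) (Fin L) ℂ) (v : fields L e T) :
    complexExtSnd H j E v = complexExt (toComplexForm (H v)) j E := rfl

/-- The second matrix derivative is the complexified second derivative, evaluated at elementary
matrices. -/
theorem matDeriv_matDeriv {f : fields L e T → ℝ} {g : fields L e T → fields L e T →L[ℝ] ℝ}
    {H : fields L e T →L[ℝ] fields L e T →L[ℝ] ℝ} {X : fields L e T}
    (hf : ∀ Y, HasFDerivAt f (g Y) Y) (hg : HasFDerivAt g H X) (i j : ι) (a b c d : Fin L) :
    matDeriv e T i a b (matDeriv e T j c d fun Y => (f Y : ℂ)) X =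
      complexExt (complexExtSnd H j (Matrix.single d c 1)).toLinearMap i (Matrix.single b a 1) := by
  have h1 : (matDeriv e T j c d fun Y => (f Y : ℂ)) = fun Y =>
      Complex.ofRealCLM (g Y (fieldPart e T j (Matrix.single d c 1))) +
        Complex.I • Complex.ofRealCLM
          (g Y (fieldPart e T j ((-Complex.I) • Matrix.single d c 1))) := by
    funext Y
    exact matDeriv_eq_of_hasFDerivAt (Complex.ofRealCLM.hasFDerivAt.comp Y (hf Y)) j c d
  refine matDeriv_eq_of_hasFDerivAt ?_ i a b
  rw [h1]
  have h2 : ∀ w : fields L e T, HasFDerivAt (fun Y => Complex.ofRealCLM (g Y w))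
      (Complex.ofRealCLM.comp (H.flip w)) X := by
    intro w
    refine Complex.ofRealCLM.hasFDerivAt.comp X ?_
    refine (hg.clm_apply (hasFDerivAt_const w X)).congr_fderiv ?_
    ext v
    simp only [add_apply, add_eq_right]
    exact map_zero (g X)
  exact (h2 _).add ((h2 _).const_smul Complex.I)

theorem twisted_ncHess {f : fields L e T → ℝ} (X : fields L e T) (i j : ι) (a b c d : Fin L) :
    times (tensTau 1 1) (ncHess e T f X i j) a b c d =
      matDeriv e T i a b (matDeriv e T j c d fun Y => (f Y : ℂ)) X := by
  simp [times, tensTau, tens, Matrix.one_apply, ncHess]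

/-! ### The superspace as a matrix algebra -/

/-- The matrix of an element of the superspace, with `(i, a, b)` as row index and `(j, d, c)` as
column index of the entry `P_{ij | ab;cd}`. The transposition in the column index turns `⋆` into
the product of matrices. -/
def toMatrix (P : Superspace ι L) : Matrix (ι × Fin L × Fin L) (ι × Fin L × Fin L) ℂ :=
  Matrix.of fun p q => P p.1 q.1 p.2.1 p.2.2 q.2.2 q.2.1

theorem toMatrix_apply (P : Superspace ι L) (i j : ι) (a b c d : Fin L) :
    toMatrix P (i, a, b) (j, d, c) = P i j a b c d := rfl

theorem toMatrix_injective : Function.Injective (toMatrix : Superspace ι L → _) := by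
  intro P Q h
  funext i j a b c d
  exact congrFun (congrFun h (i, a, b)) (j, d, c)

theorem toMatrix_superStar (P Q : Superspace ι L) :
    toMatrix (superStar P Q) = toMatrix P * toMatrix Q := by
  ext ⟨i, a, b⟩ ⟨k, d, c⟩
  rw [toMatrix_apply, Matrix.mul_apply]
  simp only [superStar, Fintype.sum_prod_type, toMatrix_apply]
  rw [Finset.sum_apply, Finset.sum_apply, Finset.sum_apply, Finset.sum_apply]
  refine Finset.sum_congr rfl fun j _ => ?_
  rw [MatrixFRG.star, Finset.sum_comm]

theorem toMatrix_add (P Q : Superspace ι L) : toMatrix (P + Q) = toMatrix P + toMatrix Q := rfl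

/-- In the corner algebra of the idempotent `u` a one-sided inverse is a two-sided inverse. -/
theorem corner_inverse {n : Type*} [Fintype n] [DecidableEq n] {u D G : Matrix n n ℂ}
    (hu : u * u = u) (huG : u * G = G) (hGu : G * u = G) (h : u * D * G = u) :
    G * D * u = u := by
  have h0 : (1 - u) * (1 - u) = 1 - u := by
    rw [mul_sub, mul_one, sub_mul, one_mul, hu, sub_self, sub_zero]
  have h1 : (u * D * u + (1 - u)) * (G + (1 - u)) = 1 := by
    have e1 : u * D * u * G = u := by rw [mul_assoc _ u G, huG, h]
    have e2 : u * D * u * u = u * D * u := by rw [mul_assoc _ u u, hu]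
    rw [add_mul, mul_add, mul_add, h0, mul_sub, mul_one, e1, e2, sub_mul, one_mul, huG]
    abel
  have h2 := mul_eq_one_comm.1 h1
  have e1 : G * (u * D * u) = G * D * u := by rw [← mul_assoc, ← mul_assoc, hGu]
  have e2 : u * (u * D * u) = u * D * u := by rw [← mul_assoc, ← mul_assoc, hu]
  rw [add_mul, mul_add, mul_add, h0, e1, sub_mul, one_mul, e2, mul_sub, mul_one, hGu, sub_self,
    sub_self, add_zero, zero_add] at h2
  rw [← sub_eq_zero] at h2 ⊢
  rw [← h2]
  abel

theorem isStarInverse_of_toMatrix {D G : Superspace ι L}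
    (hu : toMatrix (superUnit T) * toMatrix (superUnit T) = toMatrix (superUnit T : Superspace ι L))
    (huG : toMatrix (superUnit T) * toMatrix G = toMatrix G)
    (hGu : toMatrix G * toMatrix (superUnit T) = toMatrix G)
    (h : toMatrix (superUnit T) * (toMatrix D * toMatrix G) = toMatrix (superUnit T)) :
    IsStarInverse T D G := by
  rw [← mul_assoc] at h
  refine ⟨toMatrix_injective ?_, toMatrix_injective ?_, toMatrix_injective ?_⟩
  · rw [toMatrix_superStar, toMatrix_superStar, huG, hGu]
  · rw [toMatrix_superStar, toMatrix_superStar, h]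
  · rw [toMatrix_superStar, toMatrix_superStar, corner_inverse hu huG hGu h]

theorem superUnit_toMatrix_apply (i j : ι) (a b c d : Fin L) :
    toMatrix (superUnit T) (i, a, b) (j, d, c) =
      if i = j then traceProj T i (Matrix.single b a 1) c d else 0 := by
  rw [toMatrix_apply, superUnit]
  by_cases h : i = j
  · subst h
    by_cases hi : i ∈ T
    · simp only [if_true, hi, traceProj, Pi.sub_apply, Pi.smul_apply, tensTau, tens,
        Matrix.one_apply, Matrix.sub_apply, Matrix.smul_apply, Matrix.single_apply,
        smul_eq_mul]
      have : (Matrix.single b a (1 : ℂ)).trace = if a = b then 1 else 0 := by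
        by_cases hab : a = b
        · subst hab
          simp
        · rw [Matrix.trace_single_eq_of_ne b a _ (Ne.symm hab), if_neg hab]
      rw [this]
      simp only [eq_comm (a := c) (b := b), ite_and]
      split_ifs <;> simp
    · simp only [if_true, hi, if_false, traceProj, tensTau, tens, Matrix.one_apply,
        Matrix.single_apply, eq_comm (a := c) (b := b), ite_and]
      split_ifs <;> simp
  · simp [h]

theorem superUnit_toMatrix_comm (p q : ι × Fin L × Fin L) :
    toMatrix (superUnit T) p q = toMatrix (superUnit T) q p := by
  obtain ⟨i, a, b⟩ := p
  obtain ⟨j, d, c⟩ := q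
  rw [toMatrix_apply, toMatrix_apply, superUnit, superUnit]
  by_cases h : i = j
  · subst h
    simp only [if_true]
    split_ifs <;> simp only [Pi.sub_apply, Pi.smul_apply, tensTau, tens, Matrix.one_apply,
      eq_comm (a := b), eq_comm (a := d), smul_eq_mul]
    ring
  · simp [h, Ne.symm h]

/-- The unit of the superspace acts as the projection onto the traceless matrices. -/
theorem superUnit_mulVec (i : ι) (a b : Fin L) (X : ι → Matrix (Fin L) (Fin L) ℂ) :
    ∑ q : ι × Fin L × Fin L, toMatrix (superUnit T) (i, a, b) q * X q.1 q.2.1 q.2.2 =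
      traceProj T i (X i) a b := by
  simp only [Fintype.sum_prod_type]
  rw [Finset.sum_eq_single i]
  · by_cases hi : i ∈ T
    · simp only [toMatrix_apply, superUnit, if_true, hi, traceProj, Pi.sub_apply, Pi.smul_apply,
        tensTau, tens, Matrix.one_apply, Matrix.sub_apply, Matrix.smul_apply, smul_eq_mul,
        sub_mul, Finset.sum_sub_distrib, Matrix.trace, Matrix.diag_apply]
      congr 1
      · simp
      · simp [Finset.mul_sum]
    · simp [toMatrix_apply, superUnit, hi, traceProj, tensTau, tens, Matrix.one_apply]
  · intro j _ hj
    simp [toMatrix_apply, superUnit, Ne.symm hj]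
  · simp

theorem superUnit_mul_self :
    toMatrix (superUnit T) * toMatrix (superUnit T) = toMatrix (superUnit T : Superspace ι L) := by
  ext ⟨i, a, b⟩ ⟨k, d, c⟩
  rw [Matrix.mul_apply]
  refine (superUnit_mulVec i a b fun j =>
    Matrix.of fun x y => toMatrix (superUnit T) (j, x, y) (k, d, c)).trans ?_
  rw [traceProj_of_trace]
  · rfl
  · intro hi
    simp only [Matrix.trace, Matrix.diag_apply, Matrix.of_apply]
    by_cases h : k = i
    · subst h
      have h0 := trace_traceProj T k hi (Matrix.single c d (1 : ℂ))
      rw [← h0, Matrix.trace]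
      refine Finset.sum_congr rfl fun x _ => ?_
      rw [superUnit_toMatrix_comm, superUnit_toMatrix_apply]
      simp
    · refine Finset.sum_eq_zero fun x _ => ?_
      rw [superUnit_toMatrix_apply, if_neg (Ne.symm h)]

/-! ### The regulator as a quadratic form -/

/-- The real part of a matrix entry. -/
noncomputable def reCoord (e : ι → ℤˣ) (T : Finset ι) (i : ι) (a b : Fin L) :
    fields L e T →L[ℝ] ℝ := Complex.reCLM.comp (coord e T i a b)

/-- The imaginary part of a matrix entry. -/
noncomputable def imCoord (e : ι → ℤˣ) (T : Finset ι) (i : ι) (a b : Fin L) :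
    fields L e T →L[ℝ] ℝ := Complex.imCLM.comp (coord e T i a b)

@[simp] theorem reCoord_apply (i : ι) (a b : Fin L) (X : fields L e T) :
    reCoord e T i a b X = (X.1 i a b).re := rfl

@[simp] theorem imCoord_apply (i : ι) (a b : Fin L) (X : fields L e T) :
    imCoord e T i a b X = (X.1 i a b).im := rfl

/-- The coefficient of `r a b` in the regulator term, for `p = (a, b)`: half the sum of the squared
absolute values of the entries `(a, b)`. -/
noncomputable def regEntry (e : ι → ℤˣ) (T : Finset ι) (p : Fin L × Fin L) (X : fields L e T) : ℝ :=
  1 / 2 * ∑ i, Complex.normSq (X.1 i p.1 p.2)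

theorem regEntry_nonneg (p : Fin L × Fin L) (X : fields L e T) : 0 ≤ regEntry e T p X :=
  mul_nonneg (by norm_num) (Finset.sum_nonneg fun _ _ =>
    Complex.normSq_nonneg _)

theorem expBounded_normSq (i : ι) (a b : Fin L) :
    ExpBounded fun X : fields L e T => Complex.normSq (X.1 i a b) := by
  change ExpBounded fun X => reCoord e T i a b X * reCoord e T i a b X +
    imCoord e T i a b X * imCoord e T i a b X
  exact ((expBounded_clm _).mul (expBounded_clm _)).add
    ((expBounded_clm _).mul (expBounded_clm _))

theorem expBounded_regEntry (p : Fin L × Fin L) : ExpBounded (regEntry (L := L) e T p) :=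
  (expBounded_const (1 / 2 : ℝ)).mul <|
    ExpBounded.finsetSum (fun i => expBounded_normSq i p.1 p.2) _

theorem regTerm_eq (r : Fin L → Fin L → ℝ) (X : fields L e T) :
    regTerm e r X.1 = ((∑ p : Fin L × Fin L, r p.1 p.2 * regEntry e T p X : ℝ) : ℂ) := by
  have h : ∀ a b, ∑ c, ∑ d, ∑ i, ((e i : ℤ) : ℂ) * X.1 i b a * regulator r a b c d * X.1 i d c =
      (r a b : ℂ) * ∑ i, (Complex.normSq (X.1 i a b) : ℂ) := by
    intro a b
    rw [Finset.sum_eq_single b, Finset.sum_eq_single a]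
    · rw [Finset.mul_sum]
      refine Finset.sum_congr rfl fun i _ => ?_
      rw [← sign_mul_entry]
      simp [regulator, tensTau, tens]
      ring
    · intro d _ hd
      simp [regulator, tensTau, tens, Ne.symm hd]
    · simp
    · intro c _ hc
      simp [regulator, tensTau, tens, Matrix.one_apply, hc]
    · simp
  simp only [regTerm, h, Fintype.sum_prod_type, regEntry]
  push_cast
  simp only [Finset.mul_sum]
  refine Finset.sum_congr rfl fun a _ => Finset.sum_congr rfl fun b _ =>
    Finset.sum_congr rfl fun i _ => ?_
  ring

theorem re_regTerm (r : Fin L → Fin L → ℝ) (X : fields L e T) :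
    (regTerm e r X.1).re = ∑ p : Fin L × Fin L, r p.1 p.2 * regEntry e T p X := by
  rw [regTerm_eq, Complex.ofReal_re]

/-- The second derivative of the regulator term. -/
noncomputable def regHess (e : ι → ℤˣ) (T : Finset ι) (r : Fin L → Fin L → ℝ) :
    fields L e T →L[ℝ] fields L e T →L[ℝ] ℝ :=
  ∑ p : Fin L × Fin L, r p.1 p.2 • ∑ i,
    ((reCoord e T i p.1 p.2).smulRight (reCoord e T i p.1 p.2) +
      (imCoord e T i p.1 p.2).smulRight (imCoord e T i p.1 p.2))

theorem regHess_apply (r : Fin L → Fin L → ℝ) (X Y : fields L e T) :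
    regHess e T r X Y = ∑ p : Fin L × Fin L, r p.1 p.2 * ∑ i,
      ((X.1 i p.1 p.2).re * (Y.1 i p.1 p.2).re + (X.1 i p.1 p.2).im * (Y.1 i p.1 p.2).im) := by
  simp [regHess, sum_apply]

theorem hasFDerivAt_regTerm (r : Fin L → Fin L → ℝ) (X : fields L e T) :
    HasFDerivAt (fun Y : fields L e T => (regTerm e r Y.1).re) (regHess e T r X) X := by
  have h : (fun Y : fields L e T => (regTerm e r Y.1).re) =
      fun Y => 1 / 2 * regHess e T r Y Y := by
    funext Y
    rw [re_regTerm, regHess_apply, Finset.mul_sum]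
    refine Finset.sum_congr rfl fun p _ => ?_
    simp only [regEntry, Complex.normSq_apply]
    ring
  rw [h]
  refine (((regHess e T r).hasFDerivAt.clm_apply (hasFDerivAt_id X)).const_mul
    (1 / 2 : ℝ)).congr_fderiv ?_
  ext Y
  have hsymm : regHess e T r Y X = regHess e T r X Y := by
    simp only [regHess_apply]
    refine Finset.sum_congr rfl fun p _ => ?_
    congr 1
    exact Finset.sum_congr rfl fun i _ => by ring
  simp [hsymm]
  ring

/-- For a symmetric regulator, the second derivative in matrix entries. -/
theorem regHess_complex {r : Fin L → Fin L → ℝ} (hr : ∀ a c, r a c = r c a) (X Y : fields L e T) :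
    (regHess e T r X Y : ℂ) = ∑ q : ι × Fin L × Fin L,
      (((e q.1 : ℤ) : ℂ) * r q.2.1 q.2.2 * X.1 q.1 q.2.2 q.2.1) * Y.1 q.1 q.2.1 q.2.2 := by
  have h1 : ∀ q : ι × Fin L × Fin L,
      (((e q.1 : ℤ) : ℂ) * r q.2.1 q.2.2 * X.1 q.1 q.2.2 q.2.1) * Y.1 q.1 q.2.1 q.2.2 =
        r q.2.1 q.2.2 * ((starRingEnd ℂ) (X.1 q.1 q.2.1 q.2.2) * Y.1 q.1 q.2.1 q.2.2) := by
    intro q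
    rw [conj_entry]
    ring
  simp only [h1]
  -- the sum is real: conjugation exchanges the two indices of every entry
  have hreal : (starRingEnd ℂ) (∑ q : ι × Fin L × Fin L,
      r q.2.1 q.2.2 * ((starRingEnd ℂ) (X.1 q.1 q.2.1 q.2.2) * Y.1 q.1 q.2.1 q.2.2)) =
      ∑ q : ι × Fin L × Fin L,
        r q.2.1 q.2.2 * ((starRingEnd ℂ) (X.1 q.1 q.2.1 q.2.2) * Y.1 q.1 q.2.1 q.2.2) := by
    simp only [map_sum, Fintype.sum_prod_type]
    refine Finset.sum_congr rfl fun i _ => ?_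
    rw [Finset.sum_comm]
    refine Finset.sum_congr rfl fun a _ => Finset.sum_congr rfl fun b _ => ?_
    rw [map_mul, map_mul, Complex.conj_conj, Complex.conj_ofReal, conj_entry Y, conj_entry X, hr]
    ring
  rw [← Complex.conj_eq_iff_re.1 hreal, regHess_apply, Complex.re_sum]
  congr 1
  conv_rhs => rw [Fintype.sum_prod_type, Finset.sum_comm]
  refine Finset.sum_congr rfl fun p _ => ?_
  rw [Finset.mul_sum]
  refine Finset.sum_congr rfl fun i _ => ?_
  simp

/-! ### The propagator -/

/-- The tensor `e_i ∂^{X_i}_{ab} ∂^{X_j}_{cd}` of a function with second derivative `H`. -/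
noncomputable def hessTensor (e : ι → ℤˣ) (T : Finset ι)
    (H : fields L e T →L[ℝ] fields L e T →L[ℝ] ℝ) : Superspace ι L := fun i j a b c d =>
  ((e i : ℤ) : ℂ) *
    complexExt (complexExtSnd H j (Matrix.single d c 1)).toLinearMap i (Matrix.single b a 1)

theorem twisted_hessSigma {f : fields L e T → ℝ} {g : fields L e T → fields L e T →L[ℝ] ℝ}
    {H : fields L e T →L[ℝ] fields L e T →L[ℝ] ℝ} {X : fields L e T}
    (hf : ∀ Y, HasFDerivAt f (g Y) Y) (hg : HasFDerivAt g H X) :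
    twisted (hessSigma e T f X) = hessTensor e T H := by
  funext i j a b c d
  rw [hessTensor, ← matDeriv_matDeriv hf hg, ← twisted_ncHess]
  simp only [twisted, hessSigma, times, Pi.smul_apply, smul_eq_mul, Finset.mul_sum]
  exact Finset.sum_congr rfl fun x _ => Finset.sum_congr rfl fun y _ => by ring

theorem toMatrix_superRegulator (r : Fin L → Fin L → ℝ) :
    toMatrix (superRegulator r : Superspace ι L) =
      Matrix.diagonal fun p : ι × Fin L × Fin L => (r p.2.1 p.2.2 : ℂ) := by
  ext ⟨i, a, b⟩ ⟨j, d, c⟩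
  rw [toMatrix_apply, Matrix.diagonal_apply, superRegulator]
  by_cases h : i = j
  · subst h
    simp only [if_true, regulator, tensTau, tens, Matrix.one_apply, Prod.mk.injEq, true_and]
    by_cases h1 : a = d <;> by_cases h2 : c = b <;> simp [h1, h2, eq_comm (a := b)]
  · simp [h]

theorem complexExt_coord_single (i k : ι) (a b c d : Fin L) :
    complexExt (coord e T k c d).toLinearMap i (Matrix.single b a 1) =
      toMatrix (superUnit T) (i, a, b) (k, d, c) := by
  rw [complexExt_coord, superUnit_toMatrix_apply]
  by_cases h : i = k
  · subst h
    simp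
  · simp [h, Ne.symm h]

theorem superUnit_toMatrix_ne {p q : ι × Fin L × Fin L} (h : p.1 ≠ q.1) :
    toMatrix (superUnit T) p q = 0 := by
  obtain ⟨i, a, b⟩ := p
  obtain ⟨j, d, c⟩ := q
  rw [superUnit_toMatrix_apply, if_neg h]

section

variable [MeasurableSpace (fields L e T)] {μ : Measure (fields L e T)}
  {s : fields L e T → ℝ} {l : fields L e T →L[ℝ] ℝ}

/-- The connected two-point function `e_k ⟨(φ_i)_{ab}; (φ_k)_{cd}⟩` of the model with action `s` in
the presence of the source `l`. -/
noncomputable def propagator (μ : Measure (fields L e T)) (s : fields L e T → ℝ)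
    (l : fields L e T →L[ℝ] ℝ) : Superspace ι L := fun i k a b c d =>
  ((e k : ℤ) : ℂ) * complexCov μ s l (coord e T i a b) (coord e T k c d)

theorem toMatrix_propagator (p q : ι × Fin L × Fin L) :
    toMatrix (propagator μ s l) p q = ((e q.1 : ℤ) : ℂ) *
      complexCov μ s l (coord e T p.1 p.2.1 p.2.2) (coord e T q.1 q.2.2 q.2.1) := rfl

variable [BorelSpace (fields L e T)]

theorem sum_complexCov_trace (hs : Confining μ s) {i : ι} (hi : i ∈ T)
    (B : fields L e T →L[ℝ] ℂ) : ∑ x, complexCov μ s l (coord e T i x x) B = 0 :=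
  hs.sum_complexCov_eq_zero l B _ fun X => X.2.2 i hi

theorem superUnit_mul_propagator (hs : Confining μ s) :
    toMatrix (superUnit T) * toMatrix (propagator μ s l) = toMatrix (propagator μ s l) := by
  ext ⟨i, a, b⟩ q
  rw [Matrix.mul_apply]
  refine (superUnit_mulVec i a b fun j =>
    Matrix.of fun x y => toMatrix (propagator μ s l) (j, x, y) q).trans ?_
  rw [traceProj_of_trace]
  · rfl
  · intro hi
    simp only [Matrix.trace, Matrix.diag_apply, Matrix.of_apply, toMatrix_propagator]
    rw [← Finset.mul_sum, sum_complexCov_trace hs hi, mul_zero]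

theorem propagator_mul_superUnit (hs : Confining μ s) :
    toMatrix (propagator μ s l) * toMatrix (superUnit T) = toMatrix (propagator μ s l) := by
  ext p ⟨i, a, b⟩
  rw [Matrix.mul_apply]
  simp only [superUnit_toMatrix_comm (T := T) _ (i, a, b),
    mul_comm (toMatrix (propagator μ s l) p _)]
  refine (superUnit_mulVec i a b fun j =>
    Matrix.of fun x y => toMatrix (propagator μ s l) p (j, x, y)).trans ?_
  rw [traceProj_of_trace]
  · rfl
  · intro hi
    simp only [Matrix.trace, Matrix.diag_apply, Matrix.of_apply, toMatrix_propagator]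
    rw [← Finset.mul_sum]
    simp only [complexCov_comm μ s l (coord e T p.1 p.2.1 p.2.2)]
    rw [sum_complexCov_trace hs hi, mul_zero]

/-- Contracting the complexified second derivative with the covariance applies the latter to the
former. -/
theorem sum_complexExt_mul_complexCov (hs : Confining μ s)
    (H : fields L e T →L[ℝ] fields L e T →L[ℝ] ℝ) (B : fields L e T →L[ℝ] ℂ) (i : ι)
    (E : Matrix (Fin L) (Fin L) ℂ) :
    ∑ q : ι × Fin L × Fin L,
      complexExt (complexExtSnd H q.1 (Matrix.single q.2.1 q.2.2 1)).toLinearMap i E *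
        complexCov μ s l (coord e T q.1 q.2.1 q.2.2) B =
      complexExt (B.comp ((cov μ s l).comp H)).toLinearMap i E := by
  have h : ∀ v, ∑ q : ι × Fin L × Fin L,
      complexExtSnd H q.1 (Matrix.single q.2.1 q.2.2 1) v *
        complexCov μ s l (coord e T q.1 q.2.1 q.2.2) B = B (cov μ s l (H v)) := by
    intro v
    simp only [complexExtSnd_apply]
    rw [hs.clm_cov_eq_sum l (H v) B (fun q : ι × Fin L × Fin L => coord e T q.1 q.2.1 q.2.2)]
    intro X
    exact (sum_complexExt_mul (toComplexForm (H v)) X).symm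
  simp only [complexExt_apply, ContinuousLinearMap.coe_coe, add_mul, Finset.sum_add_distrib,
    mul_assoc, ← Finset.mul_sum, h]
  rfl

/-- If `H` is the inverse of the covariance minus the second derivative of the regulator term, then
the tensor of `H` times the propagator is the unit up to the contribution of the regulator. -/
theorem hessTensor_mul_propagator (hs : Confining μ s) {r : Fin L → Fin L → ℝ}
    (hr : ∀ a c, r a c = r c a) {H : fields L e T →L[ℝ] fields L e T →L[ℝ] ℝ}
    (hH : ∀ v, cov μ s l (H v) = v - cov μ s l (regHess e T r v)) :
    toMatrix (hessTensor e T H) * toMatrix (propagator μ s l) =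
      toMatrix (superUnit T) -
        toMatrix (superUnit T) * (toMatrix (superRegulator r) * toMatrix (propagator μ s l)) := by
  ext ⟨i, a, b⟩ ⟨k, d, c⟩
  set B := coord (L := L) e T k c d with hB
  set M : ι × Fin L × Fin L → ℂ := fun q => complexCov μ s l (coord e T q.1 q.2.1 q.2.2) B with hM
  have hBH : ∀ v, B (cov μ s l (H v)) = B v - ∑ q : ι × Fin L × Fin L,
      ((e q.1 : ℤ) : ℂ) * r q.2.1 q.2.2 * coord e T q.1 q.2.2 q.2.1 v * M q := by
    intro v
    rw [hH, map_sub, hs.clm_cov_eq_sum l _ B (fun q : ι × Fin L × Fin L =>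
      coord e T q.1 q.2.1 q.2.2) _ (regHess_complex hr v)]
    rfl
  have hext : complexExt (B.comp ((cov μ s l).comp H)).toLinearMap i (Matrix.single b a 1) =
      toMatrix (superUnit T) (i, a, b) (k, d, c) - ∑ q : ι × Fin L × Fin L,
        ((e q.1 : ℤ) : ℂ) * r q.2.1 q.2.2 * toMatrix (superUnit T) (i, a, b) q * M q := by
    have h1 : ∀ q : ι × Fin L × Fin L, toMatrix (superUnit T) (i, a, b) q =
        complexExt (coord e T q.1 q.2.2 q.2.1).toLinearMap i (Matrix.single b a 1) :=
      fun q => (complexExt_coord_single i q.1 a b q.2.2 q.2.1).symm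
    simp only [h1]
    simp only [complexExt_apply, ContinuousLinearMap.coe_coe, ContinuousLinearMap.comp_apply, hBH,
      mul_sub, Finset.mul_sum]
    rw [sub_add_sub_comm, ← Finset.sum_add_distrib]
    congr 1
    refine Finset.sum_congr rfl fun q _ => ?_
    ring
  have hlhs : (toMatrix (hessTensor e T H) * toMatrix (propagator μ s l)) (i, a, b) (k, d, c) =
      ((e i : ℤ) : ℂ) * ((e k : ℤ) : ℂ) *
        complexExt (B.comp ((cov μ s l).comp H)).toLinearMap i (Matrix.single b a 1) := by
    rw [Matrix.mul_apply, ← sum_complexExt_mul_complexCov hs H B, Finset.mul_sum]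
    refine Finset.sum_congr rfl fun q _ => ?_
    rw [toMatrix_propagator]
    obtain ⟨j, y, x⟩ := q
    rw [toMatrix_apply, hessTensor]
    ring
  have hunit : ((e i : ℤ) : ℂ) * ((e k : ℤ) : ℂ) * toMatrix (superUnit T) (i, a, b) (k, d, c) =
      toMatrix (superUnit T) (i, a, b) (k, d, c) := by
    by_cases h : i = k
    · subst h
      rw [sign_mul_self, one_mul]
    · rw [superUnit_toMatrix_ne h, mul_zero]
  rw [hlhs, hext, mul_sub, hunit, Matrix.sub_apply, Matrix.mul_apply, Finset.mul_sum]
  congr 1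
  refine Finset.sum_congr rfl fun q _ => ?_
  rw [toMatrix_superRegulator, Matrix.diagonal_mul, toMatrix_propagator]
  by_cases h : i = q.1
  · have hq : ((e q.1 : ℤ) : ℂ) = ((e i : ℤ) : ℂ) := by rw [h]
    change _ = _ * (_ * (_ * M q))
    rw [hq]
    linear_combination (((e k : ℤ) : ℂ) * r q.2.1 q.2.2 * toMatrix (superUnit T) (i, a, b) q * M q) *
      sign_mul_self e i
  · rw [superUnit_toMatrix_ne (T := T) (p := (i, a, b)) h]
    ring

theorem superUnit_mul_hess_mul_propagator (hs : Confining μ s) {r : Fin L → Fin L → ℝ}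
    (hr : ∀ a c, r a c = r c a) {H : fields L e T →L[ℝ] fields L e T →L[ℝ] ℝ}
    (hH : ∀ v, cov μ s l (H v) = v - cov μ s l (regHess e T r v)) :
    toMatrix (superUnit T) * (toMatrix (hessTensor e T H + superRegulator r) *
      toMatrix (propagator μ s l)) = toMatrix (superUnit T) := by
  rw [toMatrix_add, add_mul, hessTensor_mul_propagator hs hr hH, mul_add, mul_sub, ← mul_assoc,
    superUnit_mul_self]
  abel

/-- The propagator inverts the Hessian plus the regulator. -/
theorem isStarInverse_propagator (hs : Confining μ s) {r : Fin L → Fin L → ℝ}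
    (hr : ∀ a c, r a c = r c a) {H : fields L e T →L[ℝ] fields L e T →L[ℝ] ℝ}
    (hH : ∀ v, cov μ s l (H v) = v - cov μ s l (regHess e T r v)) :
    IsStarInverse T (hessTensor e T H + superRegulator r) (propagator μ s l) :=
  isStarInverse_of_toMatrix superUnit_mul_self (superUnit_mul_propagator hs)
    (propagator_mul_superUnit hs) (superUnit_mul_hess_mul_propagator hs hr hH)

theorem superTrace_superRegulator_times (r : Fin L → Fin L → ℝ) (G : Superspace ι L) :
    superTrace (superTimes (superRegulator r) G) =
      ∑ p : Fin L × Fin L, (r p.1 p.2 : ℂ) * ∑ i, G i i p.2 p.1 p.1 p.2 := by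
  have h : ∀ i a b, superTimes (superRegulator r) G i i a a b b =
      (r a b : ℂ) * G i i b a a b := by
    intro i a b
    rw [superTimes, Finset.sum_apply, Finset.sum_apply, Finset.sum_apply, Finset.sum_apply,
      Finset.sum_eq_single i]
    · simp [superRegulator, times, regulator, tensTau, tens, Matrix.one_apply]
    · intro k _ hk
      simp [superRegulator, times, Ne.symm hk]
    · simp
  simp only [superTrace, h, Fintype.sum_prod_type, Finset.mul_sum]
  rw [Finset.sum_comm]
  exact Finset.sum_congr rfl fun a _ => Finset.sum_comm

/-- The supertrace of the regulator with the propagator is the connected expectation of the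
regulator term. -/
theorem superTrace_propagator [μ.IsAddHaarMeasure] (hs : Confining μ s) (r : Fin L → Fin L → ℝ) :
    (1 / 2 : ℂ) * superTrace (superTimes (superRegulator r) (propagator μ s l)) =
      ((∑ p : Fin L × Fin L, r p.1 p.2 * (avg μ s l (regEntry e T p) -
        regEntry e T p (mean μ s l)) : ℝ) : ℂ) := by
  have hc : ∀ i a b, ((e i : ℤ) : ℂ) * complexCov μ s l (coord e T i b a) (coord e T i a b) =
      ((avg μ s l (fun X => Complex.normSq (X.1 i a b)) -
        Complex.normSq ((mean μ s l).1 i a b) : ℝ) : ℂ) := by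
    intro i a b
    have hn := expBounded_normSq (e := e) (T := T) i a b
    have h1 : ExpBounded fun X : fields L e T => coord e T i b a X * coord e T i a b X :=
      (expBounded_clm _).mul (expBounded_clm _)
    have h2 := hs.clm_avg h1 (ContinuousLinearMap.mul ℝ ℂ ((e i : ℤ) : ℂ)) l
    have h3 := hs.clm_avg hn Complex.ofRealCLM l
    simp only [ContinuousLinearMap.mul_apply', coord_apply, ← mul_assoc, sign_mul_entry,
      Complex.ofRealCLM_apply] at h2 h3
    rw [complexCov, mul_sub]
    simp only [coord_apply]
    rw [h2, ← h3, ← mul_assoc, sign_mul_entry]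
    push_cast
    rfl
  have he : ∀ p : Fin L × Fin L, avg μ s l (regEntry e T p) =
      1 / 2 * ∑ i, avg μ s l (fun X => Complex.normSq (X.1 i p.1 p.2)) := by
    intro p
    have hn := fun i => expBounded_normSq (e := e) (T := T) i p.1 p.2
    have h := hs.clm_avg (ExpBounded.finsetSum hn Finset.univ)
      ((1 / 2 : ℝ) • (1 : ℝ →L[ℝ] ℝ)) l
    rw [hs.avg_finsetSum hn] at h
    exact h.symm
  rw [superTrace_superRegulator_times, Complex.ofReal_sum, Finset.mul_sum]
  refine Finset.sum_congr rfl fun p _ => ?_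
  rw [he, regEntry]
  simp only [propagator, hc]
  rw [← Complex.ofReal_sum, Finset.sum_sub_distrib]
  push_cast
  ring

/-! ### Signs on the diagonal only -/

/-- If the tensors `D'` and `G'` arise from `D` and `G` by the conjugation with a diagonal matrix of
signs, then `G'` inverts `D'` as soon as `G` inverts `D`. -/
theorem IsStarInverse.conj_sign {D G : Superspace ι L} (h : IsStarInverse T D G) {σ : ι → ℂ}
    (hσ : ∀ i, σ i * σ i = 1) :
    IsStarInverse T (fun i j => (σ i * σ j) • D i j) (fun i j => (σ i * σ j) • G i j) := by
  set S : Matrix (ι × Fin L × Fin L) (ι × Fin L × Fin L) ℂ := Matrix.diagonal fun p => σ p.1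
    with hS
  have hconj : ∀ P : Superspace ι L,
      toMatrix (fun i j => (σ i * σ j) • P i j) = S * toMatrix P * S := by
    intro P
    ext ⟨i, a, b⟩ ⟨j, d, c⟩
    rw [hS, Matrix.mul_diagonal, Matrix.diagonal_mul, toMatrix_apply, toMatrix_apply]
    simp only [Pi.smul_apply, smul_eq_mul]
    ring
  have hSS : S * S = 1 := by
    rw [hS, Matrix.diagonal_mul_diagonal]
    simp [hσ]
  have hSu : S * toMatrix (superUnit T) = toMatrix (superUnit T) * S := by
    ext p q
    rw [hS, Matrix.diagonal_mul, Matrix.mul_diagonal]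
    by_cases hpq : p.1 = q.1
    · rw [hpq, mul_comm]
    · rw [superUnit_toMatrix_ne hpq]
      simp
  have hinv : ∀ A : Matrix (ι × Fin L × Fin L) (ι × Fin L × Fin L) ℂ,
      S * (S * A) = A := fun A => by
    rw [← mul_assoc, hSS, one_mul]
  have hSu' : ∀ A : Matrix (ι × Fin L × Fin L) (ι × Fin L × Fin L) ℂ,
      toMatrix (superUnit T) * (S * A) = S * (toMatrix (superUnit T) * A) := fun A => by
    rw [← mul_assoc, ← hSu, mul_assoc]
  have hu : S * (toMatrix (superUnit T) * S) = toMatrix (superUnit T) := by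
    rw [← hSu, hinv]
  obtain ⟨h1, h2, h3⟩ := h
  have h1 := congrArg toMatrix h1
  have h2 := congrArg toMatrix h2
  have h3 := congrArg toMatrix h3
  simp only [toMatrix_superStar] at h1 h2 h3
  refine ⟨toMatrix_injective ?_, toMatrix_injective ?_, toMatrix_injective ?_⟩ <;>
    simp only [toMatrix_superStar, hconj]
  · calc _ = (toMatrix (superUnit T) * S) * toMatrix G * (S * toMatrix (superUnit T)) := by
          simp only [mul_assoc]
      _ = S * (toMatrix (superUnit T) * toMatrix G * toMatrix (superUnit T)) * S := by
          rw [hSu]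
          simp only [mul_assoc]
          rw [hSu']
      _ = _ := by rw [h1]
  · calc _ = (toMatrix (superUnit T) * S) * toMatrix D * (S * (S * (toMatrix G * S))) := by
          simp only [mul_assoc]
      _ = S * (toMatrix (superUnit T) * toMatrix D * toMatrix G) * S := by
          rw [hinv, ← hSu]
          simp only [mul_assoc]
      _ = _ := by rw [h2, mul_assoc, hu]
  · calc _ = S * toMatrix G * (S * (S * (toMatrix D * (S * toMatrix (superUnit T))))) := by
          simp only [mul_assoc]
      _ = S * (toMatrix G * toMatrix D * toMatrix (superUnit T)) * S := by
          rw [hinv, hSu]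
          simp only [mul_assoc]
      _ = _ := by rw [h3, mul_assoc, hu]

/-- The signs whose conjugation moves the sign `e` of a pair of matrices to the diagonal. -/
theorem exists_conj_sign (h : (∀ i, e i = 1) ∨ (Fintype.card ι ≤ 2 ∧ ∀ i j, e i = e j)) :
    ∃ σ : ι → ℂ, (∀ i, σ i * σ i = 1) ∧ ∀ i j, σ i * σ j * ((e i : ℤ) : ℂ) =
      if i = j then ((e i : ℤ) : ℂ) else 1 := by
  by_cases h1 : ∀ i, e i = 1
  · exact ⟨fun _ => 1, by simp, by simp [h1]⟩
  · obtain ⟨hcard, heq⟩ := h.resolve_left h1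
    push Not at h1
    obtain ⟨i₀, hi₀⟩ := h1
    have he : ∀ i, e i = -1 := fun i =>
      (heq i i₀).trans ((Int.units_eq_one_or (e i₀)).resolve_left hi₀)
    refine ⟨fun i => if i = i₀ then 1 else -1, fun i => ?_, fun i j => ?_⟩
    · dsimp only
      split_ifs <;> simp
    · by_cases hij : i = j
      · subst hij
        rcases eq_or_ne i i₀ with h | h <;> simp [h]
      · have : i = i₀ ∨ j = i₀ := by
          by_contra! hne
          have h3 : ({i, j, i₀} : Finset ι).card = 3 := by
            rw [Finset.card_eq_three]
            exact ⟨i, j, i₀, hij, hne.1, hne.2, rfl⟩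
          have := Finset.card_le_univ ({i, j, i₀} : Finset ι)
          omega
        rcases this with rfl | rfl
        · simp [hij, Ne.symm hij, he]
        · simp [hij, he]

end

/-! ### The bare action and the sources -/

theorem continuous_freeAlgebra_lift (p : FreeAlgebra ℝ ι) :
    Continuous fun Φ : ι → Matrix (Fin L) (Fin L) ℂ => FreeAlgebra.lift ℝ Φ p := by
  induction p using FreeAlgebra.induction with
  | grade0 c => simpa using continuous_const
  | grade1 i => simpa using continuous_apply i
  | mul p q hp hq =>
    simp only [map_mul]
    exact hp.matrix_mul hq
  | add p q hp hq =>
    simp only [map_add]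
    exact hp.add hq

theorem continuous_bareAction {κ : Type*} [Fintype κ] (P : FreeAlgebra ℝ ι)
    (Ps Up : κ → FreeAlgebra ℝ ι) :
    Continuous fun Φ : fields L e T => (bareAction P Ps Up Φ.1).re := by
  have h : ∀ p : FreeAlgebra ℝ ι,
      Continuous fun Φ : fields L e T => (FreeAlgebra.lift ℝ Φ.1 p).trace := fun p =>
    ((continuous_freeAlgebra_lift p).comp continuous_subtype_val).matrix_trace
  exact Complex.continuous_re.comp ((continuous_const.mul (h P)).add
    (continuous_finsetSum _ fun α _ => (h (Ps α)).mul (h (Up α))))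

/-- The linear form `X ↦ Tr (J · X)` of a source `J`. -/
noncomputable def sourceForm (e : ι → ℤˣ) (T : Finset ι) :
    fields L e T →ₗ[ℝ] (fields L e T →L[ℝ] ℝ) where
  toFun J := LinearMap.toContinuousLinearMap
    { toFun := fun X => (sourceTerm J.1 X.1).re
      map_add' := fun X Y => by
        simp [sourceTerm, mul_add, Matrix.trace_add, Finset.sum_add_distrib]
      map_smul' := fun c X => by
        simp [sourceTerm, Matrix.trace_smul, ← Finset.mul_sum] }
  map_add' J K := by
    ext X
    simp [sourceTerm, add_mul, Matrix.trace_add, Finset.sum_add_distrib]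
  map_smul' c J := by
    ext X
    simp [sourceTerm, Matrix.trace_smul, ← Finset.mul_sum]

theorem sourceForm_apply (J X : fields L e T) :
    sourceForm e T J X = (sourceTerm J.1 X.1).re := rfl

/-- The tuple `(e_i X_i)`, whose pairing with `X` is the squared norm of `X`. -/
def signed (X : fields L e T) : fields L e T :=
  ⟨fun i => ((e i : ℤ) : ℂ) • X.1 i, fun i => by
    rw [Matrix.conjTranspose_smul, X.2.1 i]
    simp, fun i hi => by rw [Matrix.trace_smul, X.2.2 i hi, smul_zero]⟩

/-- Every linear form on the fields is the pairing with a source. -/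
theorem sourceForm_surjective : Function.Surjective (sourceForm (L := L) e T) := by
  have hinj : Function.Injective (sourceForm (L := L) e T) := by
    refine (injective_iff_map_eq_zero _).2 fun J hJ => ?_
    have h0 : sourceForm e T J (signed J) = 0 := by rw [hJ]; rfl
    have hterm : ∀ i, (J.1 i * ((e i : ℤ) : ℂ) • J.1 i).trace =
        ((∑ a, ∑ b, Complex.normSq (J.1 i a b) : ℝ) : ℂ) := by
      intro i
      simp only [Matrix.trace, Matrix.diag_apply, Matrix.mul_apply, Matrix.smul_apply, smul_eq_mul]
      push_cast
      refine Finset.sum_congr rfl fun a _ => Finset.sum_congr rfl fun b _ => ?_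
      rw [← sign_mul_entry]
      ring
    have h1 : ∑ i, ∑ a, ∑ b, Complex.normSq (J.1 i a b) = 0 := by
      rw [← h0, sourceForm_apply, sourceTerm, Complex.re_sum]
      exact Finset.sum_congr rfl fun i _ => by rw [signed, hterm, Complex.ofReal_re]
    have hn : ∀ i a, 0 ≤ ∑ b, Complex.normSq (J.1 i a b) := fun i a =>
      Finset.sum_nonneg fun b _ => Complex.normSq_nonneg _
    ext i a b
    rw [Fintype.sum_eq_zero_iff_of_nonneg fun i => Finset.sum_nonneg fun a _ => hn i a] at h1
    have h2 := congrFun h1 i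
    rw [Pi.zero_apply, Fintype.sum_eq_zero_iff_of_nonneg (hn i)] at h2
    have h3 := congrFun h2 a
    rw [Pi.zero_apply, Fintype.sum_eq_zero_iff_of_nonneg fun b => Complex.normSq_nonneg _] at h3
    exact Complex.normSq_eq_zero.1 (congrFun h3 b)
  exact surjective_of_injective_strongDual hinj

section

variable [MeasurableSpace (fields L e T)] [BorelSpace (fields L e T)] {μ : Measure (fields L e T)}
  {S : (ι → Matrix (Fin L) (Fin L) ℂ) → ℂ}

/-! ### The effective action -/

/-- The bare action together with the regulator term. -/
noncomputable def regAction (e : ι → ℤˣ) (T : Finset ι)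
    (S : (ι → Matrix (Fin L) (Fin L) ℂ) → ℂ) (r : Fin L → Fin L → ℝ) : fields L e T → ℝ :=
  perturb (fun Φ => (S Φ.1).re) (regEntry e T) fun p => r p.1 p.2

theorem confining_bareAction {κ : Type*} [Fintype κ] (P : FreeAlgebra ℝ ι)
    (Ps Up : κ → FreeAlgebra ℝ ι) (hint : ∀ J : fields L e T, Integrable (fun Φ : fields L e T =>
      Real.exp (-(bareAction P Ps Up Φ.1).re + (sourceTerm J.1 Φ.1).re)) μ) :
    Confining μ fun Φ : fields L e T => (bareAction P Ps Up Φ.1).re := by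
  refine confining_of_integrable (continuous_bareAction P Ps Up) fun l => ?_
  obtain ⟨J, rfl⟩ := sourceForm_surjective l
  exact hint J

theorem confining_regAction (hs : Confining μ fun Φ : fields L e T => (S Φ.1).re)
    {r : Fin L → Fin L → ℝ} (hr : ∀ a c, 0 ≤ r a c) : Confining μ (regAction e T S r) :=
  hs.perturbed expBounded_regEntry regEntry_nonneg fun p => hr p.1 p.2

theorem freeEnergy_eq (r : Fin L → Fin L → ℝ) (J : fields L e T) :
    freeEnergy e T μ S r J = logZ μ (regAction e T S r) (sourceForm e T J) := by
  rw [freeEnergy, logZ]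
  congr 2
  funext Φ
  rw [regAction, perturb, re_regTerm, sourceForm_apply, neg_add, ← sub_eq_add_neg]

theorem effAction_eq (r : Fin L → Fin L → ℝ) (X : fields L e T) :
    effAction e T μ S r X = (⨆ l : fields L e T →L[ℝ] ℝ, (l X - logZ μ (regAction e T S r) l)) -
      (regTerm e r X.1).re := by
  rw [effAction, ← sourceForm_surjective.iSup_comp]
  simp only [freeEnergy_eq, sourceForm_apply]

theorem contDiff_regTerm (r : Fin L → Fin L → ℝ) :
    ContDiff ℝ 2 fun X : fields L e T => (regTerm e r X.1).re := by
  rw [show (2 : WithTop ℕ∞) = 1 + 1 by norm_num, contDiff_succ_iff_fderiv]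
  refine ⟨fun X => (hasFDerivAt_regTerm r X).differentiableAt, by simp, ?_⟩
  rw [show fderiv ℝ (fun X : fields L e T => (regTerm e r X.1).re) = regHess e T r from
    funext fun X => (hasFDerivAt_regTerm r X).fderiv]
  exact (regHess e T r).contDiff

section Regulated

variable [μ.IsAddHaarMeasure] {r : Fin L → Fin L → ℝ}

theorem bddAbove_of_confining (hs : Confining μ (regAction e T S r)) (X : fields L e T) :
    BddAbove (Set.range fun J : fields L e T =>
      (sourceTerm J.1 X.1).re - freeEnergy e T μ S r J) := by
  refine (hs.steepConvex.bddAbove X).mono ?_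
  rintro _ ⟨J, rfl⟩
  exact ⟨sourceForm e T J, by simp only [freeEnergy_eq, sourceForm_apply]⟩

theorem contDiff_effAction (hs : Confining μ (regAction e T S r)) :
    ContDiff ℝ 2 (effAction e T μ S r) := by
  rw [funext (effAction_eq (μ := μ) (S := S) r)]
  exact hs.steepConvex.contDiff_legendre.sub (contDiff_regTerm r)

/-- The Hessian of the effective action plus the regulator is the Hessian of the Legendre transform,
which the propagator at the source of `X` inverts. -/
theorem isStarInverse_effAction (hs : Confining μ (regAction e T S r))
    (hr : ∀ a c, r a c = r c a) (X : fields L e T) :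
    IsStarInverse T (twisted (hessSigma e T (effAction e T μ S r) X) + superRegulator r)
      (propagator μ (regAction e T S r) (source (mean μ (regAction e T S r)) X)) := by
  have hsc := hs.steepConvex
  have hf : ∀ Y, HasFDerivAt (effAction e T μ S r)
      (source (mean μ (regAction e T S r)) Y - regHess e T r Y) Y := by
    intro Y
    rw [funext (effAction_eq (μ := μ) (S := S) r)]
    exact (hsc.hasFDerivAt_legendre Y).sub (hasFDerivAt_regTerm r Y)
  have hg : HasFDerivAt (fun Y => source (mean μ (regAction e T S r)) Y - regHess e T r Y)
      (fderiv ℝ (source (mean μ (regAction e T S r))) X - regHess e T r) X :=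
    (hsc.contDiff_source.differentiable one_ne_zero X).hasFDerivAt.sub
      (regHess e T r).hasFDerivAt
  rw [twisted_hessSigma hf hg]
  refine isStarInverse_propagator hs hr fun v => ?_
  rw [sub_apply, map_sub, hsc.hess_fderiv_source]

end Regulated

/-- With all signs `+1`, or with equal signs and at most two matrices, moving the signs to the
diagonal amounts to a conjugation by signs, which changes neither the diagonal of the inverse nor
the regulator. -/
theorem exists_isStarInverse_diag {f : fields L e T → ℝ} {X : fields L e T}
    {r dr : Fin L → Fin L → ℝ} {G : Superspace ι L}
    (hG : IsStarInverse T (twisted (hessSigma e T f X) + superRegulator r) G)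
    (he : (∀ i, e i = 1) ∨ (Fintype.card ι ≤ 2 ∧ ∀ i j, e i = e j)) :
    ∃ G' : Superspace ι L,
      IsStarInverse T (twisted (hessSigmaDiag e T f X) + superRegulator r) G' ∧
        superTrace (superTimes (superRegulator dr) G') =
          superTrace (superTimes (superRegulator dr) G) := by
  obtain ⟨σ, hσ, hσe⟩ := exists_conj_sign he
  refine ⟨fun i j => (σ i * σ j) • G i j, ?_, ?_⟩
  · have h := hG.conj_sign hσ
    have hD : (fun i j => (σ i * σ j) •
        (twisted (hessSigma e T f X) + superRegulator r : Superspace ι L) i j) =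
        twisted (hessSigmaDiag e T f X) + superRegulator r := by
      funext i j a b c d
      have h1 : σ i * σ j * twisted (hessSigma e T f X) i j a b c d =
          twisted (hessSigmaDiag e T f X) i j a b c d := by
        simp only [twisted, hessSigma, hessSigmaDiag, times, Pi.smul_apply, smul_eq_mul,
          Finset.mul_sum, ← hσe]
        exact Finset.sum_congr rfl fun x _ => Finset.sum_congr rfl fun y _ => by ring
      have h2 : σ i * σ j * (superRegulator r : Superspace ι L) i j a b c d =
          (superRegulator r : Superspace ι L) i j a b c d := by
        by_cases hij : i = j
        · subst hij
          rw [hσ, one_mul]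
        · simp [superRegulator, hij]
      simp only [Pi.add_apply, Pi.smul_apply, smul_eq_mul, mul_add, h1, h2]
    rwa [hD] at h
  · rw [superTrace_superRegulator_times, superTrace_superRegulator_times]
    simp only [hσ, one_smul]

/-- The scale derivative of the effective action: the envelope theorem for the Legendre transform,
minus the derivative of the regulator term, is the connected part of an expectation. -/
theorem hasDerivWithinAt_effAction [μ.IsAddHaarMeasure]
    (hs : Confining μ fun Φ : fields L e T => (S Φ.1).re) {r : ℝ → Fin L → Fin L → ℝ} {D : Set ℝ}
    {t₀ : ℝ} (ht₀ : t₀ ∈ D) (hr : ∀ t ∈ D, ∀ a c, 0 ≤ r t a c) {dr : Fin L → Fin L → ℝ}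
    (hdr : ∀ a c, HasDerivWithinAt (fun t => r t a c) (dr a c) D t₀) (X : fields L e T) :
    HasDerivWithinAt (fun t => (effAction e T μ S (r t) X : ℂ))
      ((1 / 2 : ℂ) * superTrace (superTimes (superRegulator dr)
        (propagator μ (regAction e T S (r t₀)) (source (mean μ (regAction e T S (r t₀))) X))))
      D t₀ := by
  have hs₀ := confining_regAction hs (hr t₀ ht₀)
  have h1 := hs.hasDerivWithinAt_legendre expBounded_regEntry regEntry_nonneg ht₀
    (r := fun t p => r t p.1 p.2) (fun t ht p => hr t ht p.1 p.2) (fun p => hdr p.1 p.2) X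
  have h2 : HasDerivWithinAt (fun t => (regTerm e (r t) X.1).re)
      (∑ p : Fin L × Fin L, dr p.1 p.2 * regEntry e T p X) D t₀ := by
    simp only [re_regTerm]
    exact HasDerivWithinAt.fun_sum fun p _ => (hdr p.1 p.2).mul_const _
  have hfun : (fun t => (effAction e T μ S (r t) X : ℂ)) = fun t =>
      (((⨆ l : fields L e T →L[ℝ] ℝ, (l X - logZ μ (regAction e T S (r t)) l)) -
        (regTerm e (r t) X.1).re : ℝ) : ℂ) := funext fun t => by rw [effAction_eq]
  rw [superTrace_propagator hs₀, hs₀.steepConvex.grad_source, hfun]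
  refine (h1.sub h2).ofReal_comp.congr_deriv ?_
  rw [← Finset.sum_sub_distrib]
  simp only [mul_sub]
  rfl

end

end Model

end MatrixFRG

open ExpFamily

theorem proposition4p1 {ι κ : Type*} [Fintype ι] [DecidableEq ι] [Fintype κ] {L : ℕ}
    -- the signs of the matrices, and the set of those matrices that are traceless
    (e : ι → ℤˣ) (T : Finset ι)
    [MeasurableSpace (fields L e T)] [BorelSpace (fields L e T)]
    -- Lebesgue measure on the space of matrices
    (μ : Measure (fields L e T)) [μ.IsAddHaarMeasure]
    -- the bare action, real valued, with a convergent partition function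
    (P : FreeAlgebra ℝ ι) (Ps Up : κ → FreeAlgebra ℝ ι)
    (hreal : ∀ Φ : fields L e T, (bareAction P Ps Up Φ.1).im = 0)
    (hint : ∀ J : fields L e T, Integrable (fun Φ : fields L e T =>
      Real.exp (-(bareAction P Ps Up Φ.1).re + (sourceTerm J.1 Φ.1).re)) μ)
    -- the regulator at the scales `0 < N ≤ Λ`
    (r : ℝ → Fin L → Fin L → ℝ)
    (hsymm : ∀ N : ℝ, 0 < N → N ≤ L → ∀ a c, r N a c = r N c a)
    (hnonneg : ∀ N : ℝ, 0 < N → N ≤ L → ∀ a c, 0 ≤ r N a c)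
    (N : ℝ) (hN : 0 < N) (hNL : N ≤ L)
    -- the derivative of the regulator in `t = log N`
    (dr : Fin L → Fin L → ℝ)
    (hdr : ∀ a c, HasDerivWithinAt (fun t => r (Real.exp t) a c) (dr a c)
      (Set.Iic (Real.log L)) (Real.log N)) :
    (∀ X : fields L e T, BddAbove (Set.range fun J : fields L e T =>
      (sourceTerm J.1 X.1).re - freeEnergy e T μ (bareAction P Ps Up) (r N) J)) ∧
    ContDiff ℝ 2 (effAction e T μ (bareAction P Ps Up) (r N)) ∧
    ∀ X : fields L e T,
      (∃ G : Superspace ι L,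
        IsStarInverse T
          (twisted (hessSigma e T (effAction e T μ (bareAction P Ps Up) (r N)) X) +
            superRegulator (r N)) G ∧
        HasDerivWithinAt
          (fun t : ℝ => (effAction e T μ (bareAction P Ps Up) (r (Real.exp t)) X : ℂ))
          ((1 / 2 : ℂ) * superTrace (superTimes (superRegulator dr) G))
          (Set.Iic (Real.log L)) (Real.log N)) ∧
      ((∀ i, e i = 1) ∨ (Fintype.card ι ≤ 2 ∧ ∀ i j, e i = e j) →
        ∃ G : Superspace ι L,
          IsStarInverse T
            (twisted (hessSigmaDiag e T (effAction e T μ (bareAction P Ps Up) (r N)) X) +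
              superRegulator (r N)) G ∧
          HasDerivWithinAt
            (fun t : ℝ => (effAction e T μ (bareAction P Ps Up) (r (Real.exp t)) X : ℂ))
            ((1 / 2 : ℂ) * superTrace (superTimes (superRegulator dr) G))
            (Set.Iic (Real.log L)) (Real.log N)) := by
  have hconf := confining_bareAction P Ps Up hint
  have hL : (0 : ℝ) < L := hN.trans_le hNL
  have hs := confining_regAction hconf (hnonneg N hN hNL)
  have hderiv := hasDerivWithinAt_effAction hconf (Set.mem_Iic.2 (Real.log_le_log hN hNL))
    (fun t ht => hnonneg _ (Real.exp_pos t) ((Real.le_log_iff_exp_le hL).1 ht)) hdr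
  rw [Real.exp_log hN] at hderiv
  refine ⟨bddAbove_of_confining hs, contDiff_effAction hs, fun X => ?_⟩
  have hinv := isStarInverse_effAction hs (hsymm N hN hNL) X
  refine ⟨⟨_, hinv, hderiv X⟩, fun he => ?_⟩
  obtain ⟨G, hG, htr⟩ := exists_isStarInverse_diag (dr := dr) hinv he
  exact ⟨G, hG, htr ▸ hderiv X⟩
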